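/- Let $n\ge 3$ and let $G$ be the ring (cycle) on the agents $N=\{1,\dots,n\}$, with edges $\{i,i+1\}$ (indices mod $n$). Every agent plays an action in $\{x,y\}$; for a payoff gain $\alpha>0$, agent $i$ has utility $U_i(a)=\sum_{j\sim i}u(a_i,a_j)$ at the joint action $a\in\mathcal A=\{x,y\}^N$, where $u(x,x)=1+\alpha$, $u(y,y)=1$ and $u(x,y)=u(y,x)=0$. A mobile intelligent adversary of capability $k$, $1\le k\le n$, employs a policy $S$ that assigns to every joint action $a\in\mathcal A$ a set $S(a)\subseteq N$ of exactly $k$ agents; for an influence set $S'\subseteq N$ the influenced utility $\tilde U_i(a,S')$ is $U_i(a)+1$ if $i\in S'$ and $a_i=y$, and $U_i(a)$ otherwise. Under log-linear learning with parameter $\beta>0$ against $S$, at each time step, with $a$ the current joint action, an agent $i$ is chosen uniformly at random and adopts the action $b\in\{x,y\}$ with probability proportional to $\exp\big(\beta\,\tilde U_i((b,a_{-i}),S(a))\big)$, while all other agents keep their actions. Let $\pi_\beta$ be the stationary distribution of this Markov chain on $\mathcal A$; a joint action is stochastically stable if it has positive probability under $\pi=\lim_{\beta\to\infty}\pi_\beta$.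 Call $\alpha>0$ susceptible to $\mathrm{MI}(k)$ if there is a policy $S$ of capability $k$ (which may depend on $\alpha$) for which $\vec y=(y,\dots,y)$ is the only stochastically stable joint action, and let $\alpha^{\rm sus}(G,\mathrm{MI}(k))$ be the supremum of the set of all susceptible $\alpha>0$. Then this set is non-empty and bounded above, and $$\alpha^{\rm sus}(G,\mathrm{MI}(k))=\begin{cases}\frac{k}{k+1}&\text{if }k\in\{1,2\},\\[2pt]\frac{n-1}{n}&\text{if }3\le k\le n-1,\\[2pt]1&\text{if }k=n.\end{cases}$$ -/

import Mathlib

namespace CoordinationGame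

/-- The two alternatives of the coordination game. -/
inductive Action where
  | x : Action
  | y : Action
  deriving DecidableEq

instance : Fintype Action where
  elems := {Action.x, Action.y}
  complete := by intro a; cases a <;> simp

/-- Joint actions of the agents `V`. -/
abbrev JointAction (V : Type*) := V → Action

/-- Everybody plays `x`. -/
def allX (V : Type*) : JointAction V := fun _ => Action.x

/-- Everybody plays `y`. -/
def allY (V : Type*) : JointAction V := fun _ => Action.y

/-- The payoff to the first player of the two-player coordination game with payoff gain `α`. -/
def payoff (α : ℝ) : Action → Action → ℝ
  | Action.x, Action.x => 1 + α
  | Action.y, Action.y => 1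
  | Action.x, Action.y => 0
  | Action.y, Action.x => 0

section

variable {V : Type*} [Fintype V] [DecidableEq V] (G : SimpleGraph V) [DecidableRel G.Adj]

/-- The utility of agent `i` in the graphical coordination game on `G`. -/
def utility (α : ℝ) (i : V) (a : JointAction V) : ℝ :=
  ∑ j ∈ G.neighborFinset i, payoff α (a i) (a j)

/-- The utility of agent `i` when the adversary influences the agents in `S`: an influenced agent
receives an additional payoff of `1` for playing `y`. -/
def influencedUtility (α : ℝ) (S : Finset V) (i : V) (a : JointAction V) : ℝ :=
  utility G α i a + if i ∈ S ∧ a i = Action.y then 1 else 0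

/-- A policy of a mobile intelligent adversary of capability `k`: a choice of exactly `k`
influenced agents for every current joint action. -/
abbrev MobilePolicy (V : Type*) (k : ℕ) := JointAction V → {S : Finset V // S.card = k}

/-- The log-linear choice rule: the probability that agent `i`, selected for revision at the
joint action `a` while the agents in `S` are influenced, chooses the action `b`. -/
noncomputable def choiceProb (α β : ℝ) (S : Finset V) (a : JointAction V) (i : V) (b : Action) :
    ℝ :=
  Real.exp (β * influencedUtility G α S i (Function.update a i b)) /
    ∑ c : Action, Real.exp (β * influencedUtility G α S i (Function.update a i c))

/-- The transition matrix of log-linear learning with parameter `β` against the policy `S`: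
an agent is selected uniformly at random and revises its action by the log-linear rule, in the
game influenced by `S a` at the current joint action `a`. -/
noncomputable def transitionMatrix {k : ℕ} (α β : ℝ) (S : MobilePolicy V k) :
    Matrix (JointAction V) (JointAction V) ℝ :=
  fun a a' => ∑ i : V, (1 / (Fintype.card V : ℝ)) *
    ∑ b : Action, if a' = Function.update a i b then choiceProb G α β (S a).1 a i b else 0

/-- `μ` is a probability vector with `μ P = μ`. -/
def IsStationaryDistribution {Ω : Type*} [Fintype Ω] (P : Matrix Ω Ω ℝ) (μ : Ω → ℝ) : Prop :=
  μ ∈ stdSimplex ℝ Ω ∧ Matrix.vecMul μ P = μ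

/-- `μ` is the limit, as `β → ∞`, of the stationary distributions of log-linear learning with
parameter `β > 0` against the policy `S`. -/
def IsLimitingDistribution {k : ℕ} (α : ℝ) (S : MobilePolicy V k) (μ : JointAction V → ℝ) :
    Prop :=
  ∃ p : ℝ → JointAction V → ℝ,
    (∀ β : ℝ, 0 < β → IsStationaryDistribution (transitionMatrix G α β S) (p β)) ∧
    ∀ a : JointAction V, Filter.Tendsto (fun β => p β a) Filter.atTop (nhds (μ a))

/-- The set of stochastically stable joint actions: those with positive probability under the
limiting distribution. -/
def stochasticallyStable {k : ℕ} (α : ℝ) (S : MobilePolicy V k) : Set (JointAction V) :=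
  {a | ∃ μ : JointAction V → ℝ, IsLimitingDistribution G α S μ ∧ 0 < μ a}

/-- The payoff gains `α > 0` for which the game is susceptible to a mobile intelligent adversary
of capability `k`: some policy makes `y` everywhere the only stochastically stable state. -/
def susceptibleGains (k : ℕ) : Set ℝ :=
  {α | 0 < α ∧ ∃ S : MobilePolicy V k, stochasticallyStable G α S = {allY V}}

/-- The susceptibility of `G` to mobile intelligent adversaries of capability `k`. -/
noncomputable def susceptibility (k : ℕ) : ℝ := sSup (susceptibleGains G k)

end

end CoordinationGame

/-! On a ring, an agent with `d` neighbours playing `x` gains `2 - d - d(1+α)` by playing `y`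
(`advantage`), plus 1 if influenced. A switch whose utility loss is `c ≥ 0` has probability
`exp(-βc)` up to a factor 2, so `c` is its resistance. Leaving `allX` costs at least `1+2α`. Leaving
`allY` costs 2 at an uninfluenced agent and 3 at an influenced one. An agent bordering an arc of `x`
joins it at no cost if uninfluenced, and at cost at most `1-α` (zero once `α ≥ 1`) if influenced.
The question is along how many steps `m` the adversary can impose this last cost: the critical gain
then solves `2 + m(1-α) = 1+2α`, that is `α = (m+1)/(m+2)`.

One agent cannot guard both ends of an arc, so `m = 0`. Two agents can, but then none is left to
make the arc shrink; an arc of one agent shrinks by itself, so `m = 1`. With three agents all arcs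
are controlled until a single `y` remains, so `m = n-2`. If everybody can be influenced, the first
step costs 3 and the critical gain is 1.

No minimal-tree analysis is needed: under a stationary distribution every function has mean drift
zero (`sum_mul_drift`). For the upper bounds, a function of the number of agents playing `x`, with
non-negative drift at mixed states, bounds the mass of `allY` by that of `allX` times a ratio of
rates (`mul_upRate_le`, `apply_allY_le`). For the lower bounds, a Lyapunov function with negative
drift outside `allY` makes the mass elsewhere vanish (`IsContaining.one_sub_le`), against a policy
supplied by `exists_isContaining`. That estimate is needed only for `α` just below the critical
value, which determines the supremum. -/

namespace CoordinationGame

open Finset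

set_option linter.unusedSectionVars false

/-! ### Stationary distributions of finite Markov chains. -/

section Stationary

variable {Ω : Type*} [Fintype Ω]

/-- A row-stochastic matrix on a non-empty finite type has a stationary distribution. -/
theorem exists_isStationaryDistribution [Nonempty Ω] [DecidableEq Ω] (P : Matrix Ω Ω ℝ)
    (hP : ∀ a b, 0 ≤ P a b) (hsum : ∀ a, ∑ b, P a b = 1) :
    ∃ μ, IsStationaryDistribution P μ := by
  have hdet : (P - 1).det = 0 := by
    rw [← Matrix.exists_mulVec_eq_zero_iff]
    refine ⟨fun _ => 1, fun h => one_ne_zero (congrFun h (Classical.arbitrary Ω)), ?_⟩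
    ext a
    simp [Matrix.mulVec, dotProduct, hsum, Matrix.one_apply]
  obtain ⟨v, hv0, hv⟩ := Matrix.exists_vecMul_eq_zero_iff.mpr hdet
  rw [Matrix.vecMul_sub, Matrix.vecMul_one, sub_eq_zero] at hv
  have hv' : ∀ b, ∑ a, v a * P a b = v b := fun b => congrFun hv b
  -- The left eigenvector `v` may change sign. Its absolute value is subinvariant by the triangle
  -- inequality, and both sides have the same total, so equality holds at every `b`.
  have hle : ∀ b, |v b| ≤ ∑ a, |v a| * P a b := fun b => by
    rw [← hv' b]
    refine (abs_sum_le_sum_abs _ _).trans (sum_le_sum fun a _ => ?_)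
    rw [abs_mul, abs_of_nonneg (hP a b)]
  have htot : ∑ b, |v b| = ∑ b, ∑ a, |v a| * P a b := by
    rw [sum_comm]
    simp [← mul_sum, hsum]
  have heq : ∀ b, |v b| = ∑ a, |v a| * P a b := fun b =>
    (sum_eq_sum_iff_of_le fun b _ => hle b).mp htot b (mem_univ b)
  have hpos : 0 < ∑ b, |v b| := by
    obtain ⟨i, hi⟩ := Function.ne_iff.mp hv0
    exact sum_pos' (fun _ _ => abs_nonneg _) ⟨i, mem_univ i, abs_pos.mpr hi⟩
  refine ⟨fun b => |v b| / ∑ b, |v b|, ⟨fun b => by positivity, ?_⟩, ?_⟩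
  · rw [← sum_div, div_self hpos.ne']
  · ext b
    simp only [Matrix.vecMul, dotProduct]
    rw [heq b, sum_div]
    exact sum_congr rfl fun a _ => by ring

theorem IsStationaryDistribution.sum_mul_eq {P : Matrix Ω Ω ℝ} {μ : Ω → ℝ}
    (h : IsStationaryDistribution P μ) (f : Ω → ℝ) :
    ∑ a, μ a * ∑ b, P a b * f b = ∑ a, μ a * f a := by
  have h2 : ∀ b, ∑ a, μ a * P a b = μ b := fun b => congrFun h.2 b
  calc ∑ a, μ a * ∑ b, P a b * f b = ∑ b, (∑ a, μ a * P a b) * f b := by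
        simp_rw [mul_sum, sum_mul]
        rw [sum_comm]
        exact sum_congr rfl fun _ _ => sum_congr rfl fun _ _ => by ring
    _ = _ := by simp_rw [h2]

end Stationary

theorem sum_action {M : Type*} [AddCommMonoid M] (f : Action → M) :
    ∑ b, f b = f Action.x + f Action.y := by
  have : (univ : Finset Action) = {Action.x, Action.y} := rfl
  rw [this, sum_pair (by decide)]

/-! ### Log-linear learning, its drift operator and a Foster–Lyapunov bound. -/

section Chain

variable {V : Type*} [Fintype V] [DecidableEq V] (G : SimpleGraph V) [DecidableRel G.Adj]

theorem choiceProb_nonneg (α β : ℝ) (S : Finset V) (a : JointAction V) (i : V) (b : Action) :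
    0 ≤ choiceProb G α β S a i b := by
  unfold choiceProb
  positivity

theorem sum_choiceProb (α β : ℝ) (S : Finset V) (a : JointAction V) (i : V) :
    ∑ b, choiceProb G α β S a i b = 1 := by
  unfold choiceProb
  rw [← sum_div, div_self]
  rw [sum_action]
  positivity

theorem choiceProb_le_one (α β : ℝ) (S : Finset V) (a : JointAction V) (i : V) (b : Action) :
    choiceProb G α β S a i b ≤ 1 := by
  rw [← sum_choiceProb G α β S a i]
  exact single_le_sum (fun c _ => choiceProb_nonneg G α β S a i c) (mem_univ b)

/-- The generator of log-linear learning, scaled by the number of agents. -/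
noncomputable def drift {k : ℕ} (α β : ℝ) (S : MobilePolicy V k) (f : JointAction V → ℝ)
    (a : JointAction V) : ℝ :=
  ∑ i, ∑ b, choiceProb G α β (S a).1 a i b * (f (Function.update a i b) - f a)

theorem transitionMatrix_nonneg {k : ℕ} (α β : ℝ) (S : MobilePolicy V k) (a b : JointAction V) :
    0 ≤ transitionMatrix G α β S a b := by
  unfold transitionMatrix
  refine sum_nonneg fun i _ => mul_nonneg (by positivity) (sum_nonneg fun c _ => ?_)
  split_ifs
  · exact choiceProb_nonneg ..
  · exact le_rfl

theorem sum_transitionMatrix_mul {k : ℕ} (α β : ℝ) (S : MobilePolicy V k)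
    (f : JointAction V → ℝ) (a : JointAction V) :
    ∑ b, transitionMatrix G α β S a b * f b =
      (1 / (Fintype.card V : ℝ)) *
        ∑ i, ∑ c, choiceProb G α β (S a).1 a i c * f (Function.update a i c) := by
  unfold transitionMatrix
  simp_rw [← mul_sum, mul_assoc, ← mul_sum, sum_mul]
  congr 1
  rw [sum_comm]
  refine sum_congr rfl fun i _ => ?_
  rw [sum_comm]
  refine sum_congr rfl fun c _ => ?_
  simp [ite_mul]

theorem sum_transitionMatrix [Nonempty V] {k : ℕ} (α β : ℝ) (S : MobilePolicy V k)
    (a : JointAction V) : ∑ b, transitionMatrix G α β S a b = 1 := by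
  have h := sum_transitionMatrix_mul G α β S (fun _ => 1) a
  simp only [mul_one, sum_choiceProb, sum_const, card_univ, nsmul_eq_mul] at h
  rw [h, one_div, inv_mul_cancel₀]
  exact_mod_cast Fintype.card_ne_zero

theorem drift_eq [Nonempty V] {k : ℕ} (α β : ℝ) (S : MobilePolicy V k) (f : JointAction V → ℝ)
    (a : JointAction V) :
    drift G α β S f a =
      Fintype.card V * (∑ b, transitionMatrix G α β S a b * f b - f a) := by
  have hn : (Fintype.card V : ℝ) ≠ 0 := by exact_mod_cast Fintype.card_ne_zero
  rw [sum_transitionMatrix_mul, mul_sub, ← mul_assoc, mul_one_div_cancel hn, one_mul]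
  unfold drift
  simp_rw [mul_sub, sum_sub_distrib, ← sum_mul, sum_choiceProb]
  simp

theorem sum_mul_drift [Nonempty V] {k : ℕ} {α β : ℝ} {S : MobilePolicy V k}
    {p : JointAction V → ℝ} (h : IsStationaryDistribution (transitionMatrix G α β S) p)
    (f : JointAction V → ℝ) : ∑ a, p a * drift G α β S f a = 0 := by
  calc ∑ a, p a * drift G α β S f a
      = ∑ a, Fintype.card V * (p a * ∑ b, transitionMatrix G α β S a b * f b - p a * f a) :=
        sum_congr rfl fun a _ => by rw [drift_eq]; ring
    _ = 0 := by rw [← mul_sum, sum_sub_distrib, h.sum_mul_eq f, sub_self, mul_zero]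

/-- If `f` has drift at most `ζ` in `z` and at most `-η` elsewhere, then the stationary mass
outside `z` is at most `ζ / η`. -/
theorem IsStationaryDistribution.one_sub_le [Nonempty V] {k : ℕ} {α β : ℝ} {S : MobilePolicy V k}
    {p : JointAction V → ℝ} (h : IsStationaryDistribution (transitionMatrix G α β S) p)
    (f : JointAction V → ℝ) (z : JointAction V) {ζ η : ℝ} (hη : 0 < η) (hζ : 0 ≤ ζ)
    (hz : drift G α β S f z ≤ ζ) (hf : ∀ a, a ≠ z → drift G α β S f a ≤ -η) :
    1 - p z ≤ ζ / η := by
  have hp0 : ∀ a, 0 ≤ p a := h.1.1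
  have hp1 : ∑ a, p a = 1 := h.1.2
  have h0 := sum_mul_drift G h f
  have e1 : p z + ∑ a ∈ univ.erase z, p a = 1 := by
    rw [add_sum_erase _ _ (mem_univ z), hp1]
  rw [← add_sum_erase _ _ (mem_univ z)] at h0
  have e2 : ∑ a ∈ univ.erase z, p a * drift G α β S f a ≤ ∑ a ∈ univ.erase z, p a * (-η) :=
    sum_le_sum fun a ha => mul_le_mul_of_nonneg_left (hf a (ne_of_mem_erase ha)) (hp0 a)
  rw [← sum_mul] at e2
  have e3 : p z * drift G α β S f z ≤ p z * ζ := mul_le_mul_of_nonneg_left hz (hp0 z)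
  have e4 : 0 ≤ ∑ a ∈ univ.erase z, p a := sum_nonneg fun a _ => hp0 a
  rw [le_div_iff₀ hη]
  nlinarith [hp0 z]

end Chain

/-! ### Edge counts and arcs in a connected 2-regular graph. -/

section Counting

variable {V : Type*} [Fintype V] [DecidableEq V] (G : SimpleGraph V) [DecidableRel G.Adj]

theorem Action.ne_x_iff {b : Action} : b ≠ Action.x ↔ b = Action.y := by
  cases b <;> simp

theorem Action.ne_y_iff {b : Action} : b ≠ Action.y ↔ b = Action.x := by
  cases b <;> simp

/-- The number of agents playing `x`. -/
def xCount (a : JointAction V) : ℕ := #{i | a i = Action.x}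

/-- The number of neighbours of `i` playing `x`. -/
def xDeg (a : JointAction V) (i : V) : ℕ := #{j ∈ G.neighborFinset i | a j = Action.x}

/-- The number of pairs of adjacent agents that both play `x`. -/
def inner (a : JointAction V) : ℕ := ∑ i with a i = Action.x, xDeg G a i

/-- The number of edges between agents playing `y` and agents playing `x`. -/
def cut (a : JointAction V) : ℕ := ∑ i with a i = Action.y, xDeg G a i

variable {G}

theorem xCount_le (a : JointAction V) : xCount a ≤ Fintype.card V := card_le_univ _

theorem xCount_eq_zero {a : JointAction V} : xCount a = 0 ↔ a = allY V := by
  simp [xCount, filter_eq_empty_iff, funext_iff, allY, Action.ne_x_iff]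

theorem xCount_eq_card {a : JointAction V} : xCount a = Fintype.card V ↔ a = allX V := by
  simp [xCount, card_eq_iff_eq_univ, filter_eq_self, funext_iff, allX]

theorem exists_eq_x {a : JointAction V} (h : 0 < xCount a) : ∃ i, a i = Action.x := by
  obtain ⟨i, hi⟩ := card_pos.mp h
  exact ⟨i, (mem_filter.mp hi).2⟩

theorem exists_eq_y {a : JointAction V} (h : xCount a < Fintype.card V) :
    ∃ i, a i = Action.y := by
  by_contra! hc
  exact h.ne (xCount_eq_card.mpr (funext fun i => Action.ne_y_iff.mp (hc i)))

theorem filter_update_x (a : JointAction V) (i : V) :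
    univ.filter (fun j => Function.update a i Action.x j = Action.x) =
      insert i (univ.filter fun j => a j = Action.x) := by
  ext j
  by_cases hj : j = i <;> simp [hj]

theorem xCount_update_x {a : JointAction V} {i : V} (h : a i = Action.y) :
    xCount (Function.update a i Action.x) = xCount a + 1 := by
  rw [xCount, filter_update_x, card_insert_of_notMem (by simp [h]), xCount]

theorem xCount_update_y {a : JointAction V} {i : V} (h : a i = Action.x) :
    xCount (Function.update a i Action.y) + 1 = xCount a := by
  have := xCount_update_x (a := Function.update a i Action.y) (i := i) (by simp)
  rw [← this]
  simp [← h]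

theorem xDeg_update_self (a : JointAction V) (i : V) (b : Action) :
    xDeg G (Function.update a i b) i = xDeg G a i := by
  unfold xDeg
  congr 1
  refine filter_congr fun j hj => ?_
  have : j ≠ i := by
    rintro rfl
    simp at hj
  simp [this]

theorem xDeg_update_x {a : JointAction V} {i : V} (h : a i = Action.y) (u : V) :
    xDeg G (Function.update a i Action.x) u = xDeg G a u + if G.Adj u i then 1 else 0 := by
  unfold xDeg
  split_ifs with hu
  · rw [← card_insert_of_notMem (a := i) (by simp [h])]
    congr 1
    ext j
    by_cases hj : j = i <;> simp [hj, hu]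
  · rw [add_zero]
    congr 1
    refine filter_congr fun j hj => ?_
    have : j ≠ i := by
      rintro rfl
      simp [hu] at hj
    simp [this]

theorem xDeg_le (hreg : ∀ v, G.degree v = 2) (a : JointAction V) (i : V) : xDeg G a i ≤ 2 := by
  rw [← hreg i, ← G.card_neighborFinset_eq_degree]
  exact card_filter_le _ _

theorem xDeg_pos {a : JointAction V} {i : V} :
    0 < xDeg G a i ↔ ∃ j, G.Adj i j ∧ a j = Action.x := by
  simp [xDeg, card_pos, Finset.Nonempty]

theorem xDeg_eq_two (hreg : ∀ v, G.degree v = 2) {a : JointAction V} {i : V} :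
    xDeg G a i = 2 ↔ ∀ j, G.Adj i j → a j = Action.x := by
  rw [← hreg i, ← G.card_neighborFinset_eq_degree, xDeg, card_filter_eq_iff]
  simp

/-- Double counting of ordered adjacent pairs whose second member plays `x`; `inner` counts each
edge inside the `x` set twice. -/
theorem cut_add_inner (hreg : ∀ v, G.degree v = 2) (a : JointAction V) :
    cut G a + inner G a = 2 * xCount a := by
  have h1 : cut G a + inner G a = ∑ i, xDeg G a i := by
    rw [← sum_filter_add_sum_filter_not univ (fun i => a i = Action.x), add_comm]
    simp only [Action.ne_x_iff]
    rfl
  have h2 : ∑ i, xDeg G a i = ∑ j with a j = Action.x, G.degree j := by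
    have : ∀ i, xDeg G a i = ∑ j with a j = Action.x, if G.Adj i j then 1 else 0 := fun i => by
      rw [xDeg, card_filter, ← sum_filter, ← sum_filter, filter_filter]
      simp only [sum_const, smul_eq_mul, mul_one]
      congr 1
      ext j
      simp [and_comm]
    simp_rw [this]
    rw [sum_comm]
    refine sum_congr rfl fun j _ => ?_
    rw [← G.card_neighborFinset_eq_degree, ← card_filter]
    congr 1
    ext i
    simp [G.adj_comm]
  rw [h1, h2]
  simp [hreg, xCount, mul_comm]

theorem inner_update_x {a : JointAction V} {i : V} (h : a i = Action.y) :
    inner G (Function.update a i Action.x) = inner G a + 2 * xDeg G a i := by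
  rw [inner, filter_update_x, sum_insert (by simp [h]), xDeg_update_self]
  simp_rw [xDeg_update_x h]
  rw [sum_add_distrib, ← card_filter, filter_filter]
  have : ({u | a u = Action.x ∧ G.Adj u i} : Finset V) =
      {j ∈ G.neighborFinset i | a j = Action.x} := by
    ext u
    simp [G.adj_comm, and_comm]
  rw [this, ← inner, ← xDeg]
  ring

theorem cut_update_x (hreg : ∀ v, G.degree v = 2) {a : JointAction V} {i : V}
    (h : a i = Action.y) :
    cut G (Function.update a i Action.x) + 2 * xDeg G a i = cut G a + 2 := by
  have h1 := cut_add_inner hreg a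
  have h2 := cut_add_inner hreg (Function.update a i Action.x)
  rw [inner_update_x h, xCount_update_x h] at h2
  omega

theorem cut_update_y (hreg : ∀ v, G.degree v = 2) {a : JointAction V} {i : V}
    (h : a i = Action.x) :
    cut G (Function.update a i Action.y) + 2 = cut G a + 2 * xDeg G a i := by
  have := cut_update_x hreg (a := Function.update a i Action.y) (i := i) (by simp)
  rw [xDeg_update_self] at this
  rw [← this]
  simp [← h]

/-- A single switch changes the cut by an even number, and at `allY` the cut is empty. With
connectedness this yields `two_le_cut`, so that `cut G a ≤ 2` expresses that the agents playing `x`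
form one arc. -/
theorem even_cut (hreg : ∀ v, G.degree v = 2) (a : JointAction V) : Even (cut G a) := by
  induction hc : xCount a generalizing a with
  | zero =>
    have := cut_add_inner hreg a
    rw [show cut G a = 0 by omega]
    exact Even.zero
  | succ c ih =>
    obtain ⟨i, hi⟩ := exists_eq_x (a := a) (by omega)
    have h1 := xCount_update_y hi
    have h2 := cut_update_y hreg hi
    have h3 := ih (Function.update a i Action.y) (by omega)
    rw [Nat.even_iff] at *
    omega

/-- In a connected graph, a property that spreads along edges holds everywhere or nowhere. -/
theorem _root_.SimpleGraph.Preconnected.forall_of_adj {G : SimpleGraph V} (hG : G.Preconnected)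
    {p : V → Prop} (h : ∀ u v, G.Adj u v → p u → p v) {u : V} (hu : p u) (v : V) : p v := by
  obtain ⟨w⟩ := hG u v
  induction w with
  | nil => exact hu
  | cons hadj _ ih => exact ih (h _ _ hadj hu)

theorem exists_adj (hG : G.Preconnected) {a : JointAction V} (h0 : 0 < xCount a)
    (h1 : xCount a < Fintype.card V) :
    ∃ u v, G.Adj u v ∧ a u = Action.x ∧ a v = Action.y := by
  obtain ⟨i, hi⟩ := exists_eq_x h0
  obtain ⟨j, hj⟩ := exists_eq_y h1
  by_contra! hc
  have := hG.forall_of_adj (p := fun v => a v = Action.x)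
    (fun u v huv hu => Action.ne_y_iff.mp (hc u v huv hu)) hi j
  simp [hj] at this

theorem exists_y_xDeg_pos (hG : G.Preconnected) {a : JointAction V} (h0 : 0 < xCount a)
    (h1 : xCount a < Fintype.card V) : ∃ v, a v = Action.y ∧ 0 < xDeg G a v := by
  obtain ⟨u, v, huv, hu, hv⟩ := exists_adj hG h0 h1
  exact ⟨v, hv, xDeg_pos.mpr ⟨u, huv.symm, hu⟩⟩

theorem exists_x_xDeg_lt (hG : G.Preconnected) (hreg : ∀ v, G.degree v = 2) {a : JointAction V}
    (h0 : 0 < xCount a) (h1 : xCount a < Fintype.card V) :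
    ∃ u, a u = Action.x ∧ xDeg G a u ≤ 1 := by
  obtain ⟨u, v, huv, hu, hv⟩ := exists_adj hG h0 h1
  refine ⟨u, hu, ?_⟩
  have h2 := xDeg_le hreg a u
  by_contra! h3
  have := (xDeg_eq_two hreg).mp (show xDeg G a u = 2 by omega) v huv
  simp [hv] at this

theorem two_le_cut (hG : G.Preconnected) (hreg : ∀ v, G.degree v = 2) {a : JointAction V}
    (h0 : 0 < xCount a) (h1 : xCount a < Fintype.card V) : 2 ≤ cut G a := by
  obtain ⟨v, hv, hd⟩ := exists_y_xDeg_pos hG h0 h1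
  have : 0 < cut G a := hd.trans_le
    (single_le_sum (f := fun i => xDeg G a i) (fun _ _ => Nat.zero_le _) (by simp [hv]))
  have he := even_cut hreg a
  rw [Nat.even_iff] at he
  omega

/-- If a single arc separates the two actions and an agent is isolated among the agents playing
`x`, then it is the only one of them. -/
theorem xCount_eq_one_of_xDeg_eq_zero (hG : G.Preconnected) (hreg : ∀ v, G.degree v = 2)
    {a : JointAction V} (hcut : cut G a ≤ 2) {i : V} (hi : a i = Action.x)
    (hd : xDeg G a i = 0) : xCount a = 1 := by
  -- Counted from the `x` side, the isolated agent `i` already uses up both cut edges. Any other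
  -- agent playing `x` would have only neighbours playing `x`, and this would spread around the
  -- graph while never reaching `i`.
  have h1 : cut G a = ∑ u with a u = Action.x, (2 - xDeg G a u) := by
    have h2 := cut_add_inner hreg a
    have h3 : ∑ u with a u = Action.x, (2 - xDeg G a u) + inner G a = 2 * xCount a := by
      rw [inner, ← sum_add_distrib, xCount, card_eq_sum_ones, mul_sum]
      exact sum_congr rfl fun u _ => by have := xDeg_le hreg a u; omega
    omega
  have hmem : i ∈ ({u | a u = Action.x} : Finset V) := by simp [hi]
  rw [← add_sum_erase _ _ hmem, hd] at h1
  have h4 : ∀ u, a u = Action.x → u ≠ i → xDeg G a u = 2 := fun u hu hui => by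
    have h5 := single_le_sum (f := fun u => 2 - xDeg G a u) (fun _ _ => Nat.zero_le _)
      (show u ∈ ({u | a u = Action.x} : Finset V).erase i by simp [hu, hui])
    have := xDeg_le hreg a u
    omega
  rw [xCount, card_eq_one]
  refine ⟨i, eq_singleton_iff_unique_mem.mpr ⟨hmem, fun u hu => ?_⟩⟩
  by_contra hui
  refine (hG.forall_of_adj (p := fun v => a v = Action.x ∧ v ≠ i) ?_
    ⟨(mem_filter.mp hu).2, hui⟩ i).2 rfl
  rintro u v huv ⟨hu, hui⟩
  refine ⟨(xDeg_eq_two hreg).mp (h4 u hu hui) v huv, ?_⟩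
  rintro rfl
  exact absurd (xDeg_pos.mpr ⟨u, huv.symm, hu⟩) (by omega)

/-- If a single arc separates the two actions and an agent is isolated among the agents playing
`y`, then it is the only one of them. -/
theorem xCount_add_one_of_xDeg_eq_two (hG : G.Preconnected) (hreg : ∀ v, G.degree v = 2)
    {a : JointAction V} (hcut : cut G a ≤ 2) {i : V} (hi : a i = Action.y)
    (hd : xDeg G a i = 2) : xCount a + 1 = Fintype.card V := by
  have hmem : i ∈ ({u | a u = Action.y} : Finset V) := by simp [hi]
  rw [cut, ← add_sum_erase _ _ hmem, hd] at hcut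
  have h4 : ∀ u, a u = Action.y → u ≠ i → xDeg G a u = 0 := fun u hu hui => by
    have h5 := single_le_sum (f := fun u => xDeg G a u) (fun _ _ => Nat.zero_le _)
      (show u ∈ ({u | a u = Action.y} : Finset V).erase i by simp [hu, hui])
    omega
  have hall : ∀ u, u ≠ i → a u = Action.x := fun u hui => by
    by_contra hu
    rw [← ne_eq, Action.ne_x_iff] at hu
    refine (hG.forall_of_adj (p := fun v => a v = Action.y ∧ v ≠ i) ?_ ⟨hu, hui⟩ i).2 rfl
    rintro u v huv ⟨hu, hui⟩
    refine ⟨?_, ?_⟩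
    · rw [← Action.ne_x_iff]
      exact fun hv => absurd (xDeg_pos.mpr ⟨v, huv, hv⟩) (by rw [h4 u hu hui]; omega)
    · rintro rfl
      have := (xDeg_eq_two hreg).mp hd u huv.symm
      simp [hu] at this
  rw [← xCount_update_x hi, xCount_eq_card]
  funext u
  by_cases hu : u = i
  · simp [hu, allX]
  · simp [hu, hall u hu, allX]

theorem card_boundary_le (a : JointAction V) :
    #{i | a i = Action.y ∧ 0 < xDeg G a i} ≤ cut G a := by
  rw [cut, card_eq_sum_ones, ← filter_filter, sum_filter]
  refine sum_le_sum fun i _ => ?_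
  split_ifs <;> omega

end Counting

/-! ### Switching probabilities as logistic functions of the utility advantage. -/

section Rates

variable {V : Type*} [Fintype V] [DecidableEq V] {G : SimpleGraph V} [DecidableRel G.Adj]

theorem utility_update_x (α : ℝ) (a : JointAction V) (i : V) :
    utility G α i (Function.update a i Action.x) = xDeg G a i * (1 + α) := by
  rw [← xDeg_update_self a i Action.x, utility, xDeg, card_filter, Nat.cast_sum, sum_mul]
  refine sum_congr rfl fun j _ => ?_
  rw [Function.update_self]
  cases Function.update a i Action.x j <;> simp [payoff]

theorem utility_update_y (hreg : ∀ v, G.degree v = 2) (α : ℝ) (a : JointAction V) (i : V) :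
    utility G α i (Function.update a i Action.y) = 2 - xDeg G a i := by
  have h2 : (2 : ℝ) = ∑ j ∈ G.neighborFinset i, 1 := by
    simp [hreg]
  rw [← xDeg_update_self a i Action.y, utility, xDeg, card_filter, Nat.cast_sum, h2,
    ← sum_sub_distrib]
  refine sum_congr rfl fun j _ => ?_
  rw [Function.update_self]
  cases Function.update a i Action.y j <;> simp [payoff]

/-- The utility advantage of `y` over `x` for agent `i`. -/
noncomputable def advantage (G : SimpleGraph V) [DecidableRel G.Adj] (α : ℝ) (S : Finset V)
    (a : JointAction V) (i : V) : ℝ :=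
  2 - xDeg G a i + (if i ∈ S then 1 else 0) - xDeg G a i * (1 + α)

theorem choiceProb_x (hreg : ∀ v, G.degree v = 2) (α β : ℝ) (S : Finset V) (a : JointAction V)
    (i : V) :
    choiceProb G α β S a i Action.x = 1 / (1 + Real.exp (β * advantage G α S a i)) := by
  rw [choiceProb, sum_action, influencedUtility, influencedUtility, utility_update_x,
    utility_update_y hreg, advantage]
  simp only [Function.update_self, and_true, reduceCtorEq, and_false, if_false, add_zero]
  rw [mul_sub, Real.exp_sub]
  field_simp

theorem choiceProb_y (hreg : ∀ v, G.degree v = 2) (α β : ℝ) (S : Finset V) (a : JointAction V)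
    (i : V) :
    choiceProb G α β S a i Action.y = 1 / (1 + Real.exp (β * -advantage G α S a i)) := by
  rw [choiceProb, sum_action, influencedUtility, influencedUtility, utility_update_x,
    utility_update_y hreg, advantage]
  simp only [Function.update_self, and_true, reduceCtorEq, and_false, if_false, add_zero]
  rw [neg_sub, mul_sub, Real.exp_sub]
  field_simp
  ring

theorem one_div_one_add_exp_le {β t c : ℝ} (hβ : 0 < β) (h : c ≤ t) :
    1 / (1 + Real.exp (β * t)) ≤ Real.exp (-(β * c)) := by
  rw [Real.exp_neg, one_div]
  have : Real.exp (β * c) ≤ Real.exp (β * t) := Real.exp_le_exp.mpr (by nlinarith)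
  exact inv_anti₀ (Real.exp_pos _) (by linarith)

/-- Since `c ≥ 0`, the exponential dominates the 1 in the denominator; this is the source of the
factor `1 / 2` in all lower bounds on rates. -/
theorem le_one_div_one_add_exp {β t c : ℝ} (hβ : 0 < β) (hc : 0 ≤ c) (h : t ≤ c) :
    Real.exp (-(β * c)) / 2 ≤ 1 / (1 + Real.exp (β * t)) := by
  have h1 : Real.exp (β * t) ≤ Real.exp (β * c) := Real.exp_le_exp.mpr (by nlinarith)
  have h2 : 1 ≤ Real.exp (β * c) := Real.one_le_exp (by positivity)
  rw [Real.exp_neg, div_le_div_iff₀ (by norm_num) (by positivity), inv_mul_le_iff₀ (by positivity)]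
  linarith

theorem choiceProb_x_le (hreg : ∀ v, G.degree v = 2) {α β : ℝ} (hβ : 0 < β) {S : Finset V}
    {a : JointAction V} {i : V} {c : ℝ} (h : c ≤ advantage G α S a i) :
    choiceProb G α β S a i Action.x ≤ Real.exp (-(β * c)) := by
  rw [choiceProb_x hreg]
  exact one_div_one_add_exp_le hβ h

theorem le_choiceProb_x (hreg : ∀ v, G.degree v = 2) {α β : ℝ} (hβ : 0 < β) {S : Finset V}
    {a : JointAction V} {i : V} {c : ℝ} (hc : 0 ≤ c) (h : advantage G α S a i ≤ c) :
    Real.exp (-(β * c)) / 2 ≤ choiceProb G α β S a i Action.x := by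
  rw [choiceProb_x hreg]
  exact le_one_div_one_add_exp hβ hc h

theorem choiceProb_y_le (hreg : ∀ v, G.degree v = 2) {α β : ℝ} (hβ : 0 < β) {S : Finset V}
    {a : JointAction V} {i : V} {c : ℝ} (h : advantage G α S a i ≤ -c) :
    choiceProb G α β S a i Action.y ≤ Real.exp (-(β * c)) := by
  rw [choiceProb_y hreg]
  exact one_div_one_add_exp_le hβ (by linarith)

theorem le_choiceProb_y (hreg : ∀ v, G.degree v = 2) {α β : ℝ} (hβ : 0 < β) {S : Finset V}
    {a : JointAction V} {i : V} {c : ℝ} (hc : 0 ≤ c) (h : -c ≤ advantage G α S a i) :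
    Real.exp (-(β * c)) / 2 ≤ choiceProb G α β S a i Action.y := by
  rw [choiceProb_y hreg]
  exact le_one_div_one_add_exp hβ hc (by linarith)

/-- The drift, split into the agents switching to `x` and those switching to `y`. -/
theorem drift_eq_add {k : ℕ} (α β : ℝ) (S : MobilePolicy V k) (f : JointAction V → ℝ)
    (a : JointAction V) :
    drift G α β S f a =
      ∑ i with a i = Action.y, choiceProb G α β (S a).1 a i Action.x *
        (f (Function.update a i Action.x) - f a) +
      ∑ i with a i = Action.x, choiceProb G α β (S a).1 a i Action.y *
        (f (Function.update a i Action.y) - f a) := by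
  rw [drift, sum_filter, sum_filter, ← sum_add_distrib]
  refine sum_congr rfl fun i _ => ?_
  rw [sum_action]
  cases h : a i
  · have : Function.update a i Action.x = a := by rw [← h, Function.update_eq_self]
    simp [this]
  · have : Function.update a i Action.y = a := by rw [← h, Function.update_eq_self]
    simp [this]

end Rates

/-! ### Upper bounds: comparison with a birth and death chain. -/

section Upper

variable {V : Type*} [Fintype V] [DecidableEq V] {G : SimpleGraph V} [DecidableRel G.Adj]

/-- The total rate at which agents switch from `y` to `x`. -/
noncomputable def upRate (G : SimpleGraph V) [DecidableRel G.Adj] (α β : ℝ) (S : Finset V)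
    (a : JointAction V) : ℝ :=
  ∑ i with a i = Action.y, choiceProb G α β S a i Action.x

/-- The total rate at which agents switch from `x` to `y`. -/
noncomputable def downRate (G : SimpleGraph V) [DecidableRel G.Adj] (α β : ℝ) (S : Finset V)
    (a : JointAction V) : ℝ :=
  ∑ i with a i = Action.x, choiceProb G α β S a i Action.y

theorem downRate_nonneg (α β : ℝ) (S : Finset V) (a : JointAction V) :
    0 ≤ downRate G α β S a :=
  sum_nonneg fun _ _ => choiceProb_nonneg ..

theorem sum_filter_le_card_mul {p : V → Prop} [DecidablePred p] {f : V → ℝ} {c : ℝ}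
    (hc : 0 ≤ c) (h : ∀ i, p i → f i ≤ c) : ∑ i with p i, f i ≤ Fintype.card V * c := by
  refine (sum_le_card_nsmul _ _ c fun i hi => h i (mem_filter.mp hi).2).trans ?_
  rw [nsmul_eq_mul]
  exact mul_le_mul_of_nonneg_right (by exact_mod_cast card_le_univ _) hc

theorem downRate_le_card (α β : ℝ) (S : Finset V) (a : JointAction V) :
    downRate G α β S a ≤ Fintype.card V := by
  rw [← mul_one (Fintype.card V : ℝ)]
  exact sum_filter_le_card_mul zero_le_one fun _ _ => choiceProb_le_one ..

theorem le_upRate (hreg : ∀ v, G.degree v = 2) {α β : ℝ} (hβ : 0 < β) {S : Finset V}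
    {a : JointAction V} {i : V} {c : ℝ} (hi : a i = Action.y) (hc : 0 ≤ c)
    (h : advantage G α S a i ≤ c) : Real.exp (-(β * c)) / 2 ≤ upRate G α β S a :=
  (le_choiceProb_x hreg hβ hc h).trans
    (single_le_sum (f := fun i => choiceProb G α β S a i Action.x)
      (fun _ _ => choiceProb_nonneg ..) (by simp [hi]))

theorem drift_comp_xCount {k : ℕ} (α β : ℝ) (S : MobilePolicy V k) (F : ℕ → ℝ)
    (a : JointAction V) :
    drift G α β S (fun a => F (xCount a)) a =
      upRate G α β (S a).1 a * (F (xCount a + 1) - F (xCount a)) -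
        downRate G α β (S a).1 a * (F (xCount a) - F (xCount a - 1)) := by
  rw [drift_eq_add, upRate, downRate, sum_mul, sum_mul, sub_eq_add_neg, ← sum_neg_distrib]
  congr 1
  · refine sum_congr rfl fun i hi => ?_
    rw [xCount_update_x (by simpa using hi)]
  · refine sum_congr rfl fun i hi => ?_
    rw [← xCount_update_y (a := a) (i := i) (by simpa using hi), Nat.add_sub_cancel]
    ring

/-- Comparison with a birth and death chain: a sequence of increments for which the number of
agents playing `x` has non-negative drift bounds the stationary mass of `allY V` by that of
`allX V`. -/
theorem IsStationaryDistribution.mul_upRate_le [Nonempty V] {k : ℕ} {α β : ℝ}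
    {S : MobilePolicy V k} {p : JointAction V → ℝ}
    (h : IsStationaryDistribution (transitionMatrix G α β S) p) (δ : ℕ → ℝ)
    (hδ : ∀ a, 0 < xCount a → xCount a < Fintype.card V →
      downRate G α β (S a).1 a * δ (xCount a - 1) ≤ upRate G α β (S a).1 a * δ (xCount a)) :
    p (allY V) * (upRate G α β (S (allY V)).1 (allY V) * δ 0) ≤
      p (allX V) *
        (downRate G α β (S (allX V)).1 (allX V) * δ (Fintype.card V - 1)) := by
  have hcard : 0 < Fintype.card V := Fintype.card_pos
  set f : JointAction V → ℝ := fun a => ∑ l ∈ range (xCount a), δ l with hf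
  have hdrift : ∀ a, drift G α β S f a = upRate G α β (S a).1 a * δ (xCount a) -
      downRate G α β (S a).1 a * (∑ l ∈ range (xCount a), δ l -
        ∑ l ∈ range (xCount a - 1), δ l) := fun a => by
    rw [hf, drift_comp_xCount α β S (fun j => ∑ l ∈ range j, δ l), sum_range_succ,
      add_sub_cancel_left]
  have hstep : ∀ a : JointAction V, 0 < xCount a → ∑ l ∈ range (xCount a), δ l -
      ∑ l ∈ range (xCount a - 1), δ l = δ (xCount a - 1) := fun a ha => by
    obtain ⟨c, hc⟩ := Nat.exists_eq_add_of_lt ha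
    rw [hc, Nat.zero_add, Nat.add_sub_cancel, sum_range_succ, add_sub_cancel_left]
  have hY : xCount (allY V) = 0 := xCount_eq_zero.mpr rfl
  have hX : xCount (allX V) = Fintype.card V := xCount_eq_card.mpr rfl
  have hXY : allX V ≠ allY V := fun he => by rw [he, hY] at hX; omega
  have hupX : upRate G α β (S (allX V)).1 (allX V) = 0 := by
    simp [upRate, allX]
  -- At mixed states the drift is non-negative, so only the two unanimous states matter: only upward
  -- moves contribute at `allY`, only downward moves at `allX`. Summing against `p` gives zero in
  -- total.
  have key : ∀ a, (if a = allY V then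
        p (allY V) * (upRate G α β (S (allY V)).1 (allY V) * δ 0) else 0) -
      (if a = allX V then p (allX V) *
        (downRate G α β (S (allX V)).1 (allX V) * δ (Fintype.card V - 1)) else 0) ≤
      p a * drift G α β S f a := fun a => by
    rw [hdrift]
    by_cases h1 : a = allY V
    · subst h1
      simp [hXY.symm, hY]
    by_cases h2 : a = allX V
    · subst h2
      rw [hstep _ (by omega), hX, hupX]
      simp [hXY]
    have h3 : 0 < xCount a := Nat.pos_of_ne_zero fun h0 => h1 (xCount_eq_zero.mp h0)
    have h4 : xCount a < Fintype.card V :=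
      lt_of_le_of_ne (xCount_le a) fun h0 => h2 (xCount_eq_card.mp h0)
    rw [if_neg h1, if_neg h2, hstep a h3, sub_zero]
    exact mul_nonneg (h.1.1 a) (sub_nonneg.mpr (hδ a h3 h4))
  have hsum := sum_le_sum fun a (_ : a ∈ univ) => key a
  rw [sum_mul_drift G h, sum_sub_distrib, sum_ite_eq' univ, sum_ite_eq' univ] at hsum
  simpa using hsum

/-- A deviator gives up `2(1+α)` and recovers at most the adversary's payment of 1. -/
theorem downRate_allX_le (hreg : ∀ v, G.degree v = 2) {α β : ℝ} (hβ : 0 < β) (S : Finset V) :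
    downRate G α β S (allX V) ≤ Fintype.card V * Real.exp (-(β * (1 + 2 * α))) := by
  refine sum_filter_le_card_mul (Real.exp_pos _).le fun i _ => choiceProb_y_le hreg hβ ?_
  have : xDeg G (allX V) i = 2 := (xDeg_eq_two hreg).mpr fun _ _ => rfl
  rw [advantage, this]
  push_cast
  split_ifs <;> linarith

/-- If, up to `m` agents playing `x`, the spread of `x` has resistance at most `ρ`, and if it is
at least comparable to the spread of `y` from then on, then the stationary mass of `allY V` is
exponentially small as soon as leaving `allX V` has a larger resistance than the path from
`allY V` to `allX V`. -/
theorem IsStationaryDistribution.apply_allY_le [Nonempty V] (hreg : ∀ v, G.degree v = 2) {k : ℕ}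
    {α β ρ r : ℝ} (hβ : 0 < β) (hρ : 0 ≤ ρ) {m : ℕ} {S : MobilePolicy V k}
    {p : JointAction V → ℝ} (h : IsStationaryDistribution (transitionMatrix G α β S) p)
    (hup : ∀ a, 0 < xCount a → xCount a < Fintype.card V → xCount a ≤ m →
      Real.exp (-(β * ρ)) / 2 ≤ upRate G α β (S a).1 a)
    (htrap : ∀ a, m < xCount a → xCount a < Fintype.card V →
      downRate G α β (S a).1 a ≤ 2 * Fintype.card V * upRate G α β (S a).1 a)
    (hY : Real.exp (-(β * r)) / 2 ≤ upRate G α β (S (allY V)).1 (allY V)) :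
    p (allY V) ≤ (2 * Fintype.card V) ^ Fintype.card V *
      Real.exp (-(β * (1 + 2 * α - r - ρ * m))) := by
  have hcard : 0 < Fintype.card V := Fintype.card_pos
  set N := Fintype.card V with hN
  have hN0 : (0 : ℝ) < N := by exact_mod_cast hcard
  -- Each increment grows by `2N` to offset `downRate ≤ N` against the `1/2` in the rate bounds, and
  -- during the first `m` steps also by `exp(βρ)` to pay the resistance `ρ`.
  set δ : ℕ → ℝ := fun l => (2 * N) ^ l * Real.exp (β * ρ * (min l m : ℕ)) with hδ
  have hδ0 : ∀ l, 0 < δ l := fun l => by positivity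
  have main := h.mul_upRate_le δ fun a h0 h1 => by
    obtain ⟨c, hc⟩ : ∃ c, xCount a = c + 1 := ⟨xCount a - 1, by omega⟩
    have hs := downRate_nonneg (G := G) α β (S a).1 a
    rw [hc, Nat.add_sub_cancel]
    by_cases hm : xCount a ≤ m
    · have e1 : δ (c + 1) = 2 * N * Real.exp (β * ρ) * δ c := by
        simp only [hδ]
        rw [min_eq_left (by omega), min_eq_left (by omega), pow_succ]
        push_cast
        rw [mul_add, mul_one, Real.exp_add]
        ring
      have e2 := hup a h0 h1 hm
      rw [Real.exp_neg] at e2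
      have e3 : N ≤ upRate G α β (S a).1 a * (2 * N * Real.exp (β * ρ)) := by
        calc (N : ℝ) = ((Real.exp (β * ρ))⁻¹ / 2) * (2 * N * Real.exp (β * ρ)) := by
              field_simp
          _ ≤ _ := mul_le_mul_of_nonneg_right e2 (by positivity)
      rw [e1, ← mul_assoc (upRate _ _ _ _ _)]
      exact mul_le_mul_of_nonneg_right ((downRate_le_card (G := G) α β (S a).1 a).trans e3)
        (hδ0 c).le
    · have e1 : δ (c + 1) = 2 * N * δ c := by
        simp only [hδ]
        rw [min_eq_right (by omega), min_eq_right (by omega), pow_succ]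
        ring
      rw [e1, ← mul_assoc (upRate _ _ _ _ _)]
      refine mul_le_mul_of_nonneg_right ?_ (hδ0 c).le
      linarith [htrap a (by omega) h1]
  have hp0 := h.1.1 (allY V)
  have hp1 : p (allX V) ≤ 1 := by
    rw [← h.1.2]
    exact single_le_sum (fun a _ => h.1.1 a) (mem_univ _)
  have e0 : δ 0 = 1 := by simp [hδ]
  have e1 : δ (N - 1) ≤ (2 * N) ^ (N - 1) * Real.exp (β * ρ * m) := by
    refine mul_le_mul_of_nonneg_left (Real.exp_le_exp.mpr ?_) (by positivity)
    exact mul_le_mul_of_nonneg_left (by exact_mod_cast min_le_right _ _) (by positivity)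
  have e2 : p (allY V) * (Real.exp (-(β * r)) / 2) ≤
      N * Real.exp (-(β * (1 + 2 * α))) * ((2 * N) ^ (N - 1) * Real.exp (β * ρ * m)) := by
    calc _ ≤ p (allY V) * (upRate G α β (S (allY V)).1 (allY V) * δ 0) := by
          rw [e0, mul_one]
          exact mul_le_mul_of_nonneg_left hY hp0
      _ ≤ _ := main
      _ ≤ 1 * (downRate G α β (S (allX V)).1 (allX V) * δ (N - 1)) :=
          mul_le_mul_of_nonneg_right hp1
            (mul_nonneg (downRate_nonneg ..) (hδ0 _).le)
      _ ≤ _ := by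
          rw [one_mul]
          exact mul_le_mul (downRate_allX_le hreg hβ _) e1 (hδ0 _).le (by positivity)
  have e3 : (2 * N : ℝ) ^ N = 2 * N * (2 * N) ^ (N - 1) := by
    rw [← pow_succ', Nat.sub_add_cancel hcard]
  have e4 : Real.exp (-(β * (1 + 2 * α - r - ρ * m))) =
      Real.exp (-(β * (1 + 2 * α))) * Real.exp (β * ρ * m) / Real.exp (-(β * r)) := by
    rw [← Real.exp_add, ← Real.exp_sub]
    congr 1
    ring
  rw [e3, e4, ← mul_div_assoc, le_div_iff₀ (Real.exp_pos _)]
  linarith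

/-- The rate bounds are uniform over influence sets of size `k`, so no policy escapes them: the path
from `allY` to `allX` costs `r + ρm`, less than the way back, and `allY` loses its mass in the
limit. -/
theorem notMem_susceptibleGains [Nonempty V] (hreg : ∀ v, G.degree v = 2) {k m : ℕ}
    {α ρ r : ℝ} (hρ : 0 ≤ ρ) (hα : r + ρ * m < 1 + 2 * α)
    (hup : ∀ β : ℝ, 0 < β → ∀ (S : Finset V) (a : JointAction V), S.card = k →
      0 < xCount a → xCount a < Fintype.card V → xCount a ≤ m →
        Real.exp (-(β * ρ)) / 2 ≤ upRate G α β S a)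
    (htrap : ∀ β : ℝ, 0 < β → ∀ (S : Finset V) (a : JointAction V), S.card = k →
      0 < xCount a → xCount a < Fintype.card V → m < xCount a →
        downRate G α β S a ≤ 2 * Fintype.card V * upRate G α β S a)
    (hY : ∀ β : ℝ, 0 < β → ∀ S : Finset V, S.card = k →
      Real.exp (-(β * r)) / 2 ≤ upRate G α β S (allY V)) :
    α ∉ susceptibleGains G k := by
  rintro ⟨-, S, hS⟩
  have hmem : allY V ∈ stochasticallyStable G α S := by
    rw [hS]
    exact Set.mem_singleton _
  obtain ⟨μ, ⟨p, hp, hlim⟩, hμ⟩ := hmem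
  have hexp : Filter.Tendsto (fun β : ℝ => ((2 * Fintype.card V) ^ Fintype.card V : ℝ) *
      Real.exp (-(β * (1 + 2 * α - r - ρ * m)))) Filter.atTop (nhds 0) := by
    rw [← mul_zero ((2 * Fintype.card V) ^ Fintype.card V : ℝ)]
    refine Filter.Tendsto.const_mul _ (Real.tendsto_exp_neg_atTop_nhds_zero.comp ?_)
    exact Filter.tendsto_id.atTop_mul_const (by linarith)
  have hle : μ (allY V) ≤ 0 := by
    refine le_of_tendsto_of_tendsto (hlim (allY V)) hexp ?_
    filter_upwards [Filter.eventually_gt_atTop (0 : ℝ)] with β hβ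
    exact (hp β hβ).apply_allY_le hreg hβ hρ
      (fun a h0 h1 hm => hup β hβ _ a (S a).2 h0 h1 hm)
      (fun a hm h1 => htrap β hβ _ a (S a).2 (by omega) h1 hm)
      (hY β hβ _ (S _).2)
  linarith

theorem exp_le_upRate_allY (hreg : ∀ v, G.degree v = 2) {α β : ℝ} (hβ : 0 < β) {S : Finset V}
    (hS : S.card < Fintype.card V) :
    Real.exp (-(β * 2)) / 2 ≤ upRate G α β S (allY V) := by
  obtain ⟨i, hi⟩ : ∃ i, i ∉ S := by
    by_contra! hc
    exact hS.ne ((card_eq_iff_eq_univ S).mpr (eq_univ_of_forall hc))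
  refine le_upRate hreg hβ (i := i) rfl zero_le_two ?_
  have : xDeg G (allY V) i = 0 := by simp [xDeg, allY]
  simp [advantage, this, hi]

theorem exp_three_le_upRate_allY [Nonempty V] (hreg : ∀ v, G.degree v = 2) {α β : ℝ}
    (hβ : 0 < β) (S : Finset V) : Real.exp (-(β * 3)) / 2 ≤ upRate G α β S (allY V) := by
  refine le_upRate hreg hβ (i := Classical.arbitrary V) rfl zero_le_three ?_
  have : xDeg G (allY V) (Classical.arbitrary V) = 0 := by simp [xDeg, allY]
  rw [advantage, this]
  split_ifs <;> norm_num

/-- An agent playing `y` next to an `x` loses at most `1 + 1 - (1 + α)` by joining, even when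
influenced. -/
theorem exp_le_upRate (hG : G.Preconnected) (hreg : ∀ v, G.degree v = 2) {α β ρ : ℝ}
    (hβ : 0 < β) (hα : 0 < α) (hρ : 0 ≤ ρ) (hρα : 1 - α ≤ ρ) (S : Finset V) {a : JointAction V}
    (h0 : 0 < xCount a) (h1 : xCount a < Fintype.card V) :
    Real.exp (-(β * ρ)) / 2 ≤ upRate G α β S a := by
  obtain ⟨v, hv, hd⟩ := exists_y_xDeg_pos hG h0 h1
  refine le_upRate hreg hβ hv hρ ?_
  have hd' : (1 : ℝ) ≤ xDeg G a v := by exact_mod_cast hd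
  rw [advantage]
  split_ifs <;> nlinarith

theorem downRate_le_of_half_le {α β : ℝ} {S : Finset V} {a : JointAction V}
    (h : Real.exp (-(β * 0)) / 2 ≤ upRate G α β S a) :
    downRate G α β S a ≤ 2 * Fintype.card V * upRate G α β S a := by
  rw [mul_zero, neg_zero, Real.exp_zero] at h
  have h1 := downRate_le_card (G := G) α β S a
  have h2 : (0 : ℝ) ≤ Fintype.card V := Nat.cast_nonneg _
  nlinarith

/-- Either some agent playing `y` switches to `x` without resistance, or the boundary of the
agents playing `y` is controlled by the influenced agents. -/
theorem half_le_upRate_or_cut_le (hreg : ∀ v, G.degree v = 2) {α β : ℝ} (hβ : 0 < β)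
    (hα : 0 < α) (S : Finset V) (a : JointAction V) :
    Real.exp (-(β * 0)) / 2 ≤ upRate G α β S a ∨ cut G a ≤ #{i ∈ S | a i = Action.y} := by
  by_cases hex : ∃ i, a i = Action.y ∧ 0 < xDeg G a i ∧ (xDeg G a i = 2 ∨ i ∉ S)
  · obtain ⟨i, hi, hd, h2⟩ := hex
    refine Or.inl (le_upRate hreg hβ hi le_rfl ?_)
    have hd' : (1 : ℝ) ≤ xDeg G a i := by exact_mod_cast hd
    rw [advantage]
    rcases h2 with h2 | h2
    · rw [h2]
      push_cast
      split_ifs <;> linarith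
    · rw [if_neg h2]
      nlinarith
  · push Not at hex
    right
    have : ({i ∈ S | a i = Action.y} : Finset V) =
        {i ∈ ({i | a i = Action.y} : Finset V) | i ∈ S} := by
      ext i
      simp [and_comm]
    rw [this, card_filter, cut]
    refine sum_le_sum fun i hi => ?_
    have h2 := xDeg_le hreg a i
    rcases Nat.eq_zero_or_pos (xDeg G a i) with h0 | h0
    · omega
    · obtain ⟨h3, h4⟩ := hex i (by simpa using hi) h0
      rw [if_pos h4]
      omega

/-- Guarding the two cut edges uses up both influenced agents, so nobody playing `x` is influenced.
An arc of at least two agents has no isolated member, hence shrinking it costs at least `α ≥ ρ`, no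
less than the bound for growing it. -/
theorem downRate_le_of_card_le_two (hG : G.Preconnected) (hreg : ∀ v, G.degree v = 2)
    {α β ρ : ℝ} (hβ : 0 < β) (hα : 0 < α) (hρ : 0 ≤ ρ) (hρα : 1 - α ≤ ρ) (hρα' : ρ ≤ α)
    {S : Finset V} (hS : S.card ≤ 2) {a : JointAction V} (h0 : 0 < xCount a)
    (h1 : xCount a < Fintype.card V) (h : 1 < xCount a) :
    downRate G α β S a ≤ 2 * Fintype.card V * upRate G α β S a := by
  rcases half_le_upRate_or_cut_le hreg hβ hα S a with hu | hc
  · exact downRate_le_of_half_le hu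
  have hcut := two_le_cut hG hreg h0 h1
  have hle : #{i ∈ S | a i = Action.y} ≤ #S := card_filter_le _ _
  have hall := (card_filter_eq_iff (s := S) (p := fun i => a i = Action.y)).mp (by omega)
  have hd : downRate G α β S a ≤ Fintype.card V * Real.exp (-(β * α)) := by
    refine sum_filter_le_card_mul (Real.exp_pos _).le fun i hi => choiceProb_y_le hreg hβ ?_
    have hiS : i ∉ S := fun hiS => by simpa [hi] using hall i hiS
    have hd0 : 1 ≤ xDeg G a i := by
      by_contra hd
      have := xCount_eq_one_of_xDeg_eq_zero hG hreg (by omega) hi (by omega)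
      omega
    have hd1 : (1 : ℝ) ≤ xDeg G a i := by exact_mod_cast hd0
    rw [advantage, if_neg hiS]
    nlinarith
  have hu := exp_le_upRate hG hreg hβ hα hρ hρα S h0 h1
  have he : Real.exp (-(β * α)) ≤ Real.exp (-(β * ρ)) := Real.exp_le_exp.mpr (by nlinarith)
  have hN : (0 : ℝ) ≤ Fintype.card V := Nat.cast_nonneg _
  nlinarith

/-- One influenced agent cannot cover a cut of at least two edges, so after the first step of cost 2
the spread of `x` is free: `2 < 1 + 2α` suffices. -/
theorem le_of_mem_susceptibleGains_one [Nonempty V] (hG : G.Preconnected)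
    (hreg : ∀ v, G.degree v = 2) (hV : 3 ≤ Fintype.card V) {α : ℝ}
    (h : α ∈ susceptibleGains G 1) : α ≤ 1 / 2 := by
  by_contra! hα
  refine notMem_susceptibleGains (m := 0) (ρ := 0) (r := 2) hreg le_rfl (by norm_num; linarith)
    (fun β _ S a _ h0 _ hm => by omega) (fun β hβ S a hS h0 h1 _ => ?_)
    (fun β hβ S hS => exp_le_upRate_allY hreg hβ (by omega)) h
  rcases half_le_upRate_or_cut_le hreg hβ h.1 S a with hu | hc
  · exact downRate_le_of_half_le hu
  · have hcut := two_le_cut hG hreg h0 h1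
    have hle : #{i ∈ S | a i = Action.y} ≤ #S := card_filter_le _ _
    omega

/-- Only the growth from one agent to two must be paid for in the comparison: for `α ≤ 1` the
condition is `2 + (1 - α) < 1 + 2α`. -/
theorem le_of_mem_susceptibleGains_two [Nonempty V] (hG : G.Preconnected)
    (hreg : ∀ v, G.degree v = 2) (hV : 3 ≤ Fintype.card V) {α : ℝ}
    (h : α ∈ susceptibleGains G 2) : α ≤ 2 / 3 := by
  by_contra! hα
  have hρ : 0 ≤ max 0 (1 - α) := le_max_left _ _
  have hρα : max 0 (1 - α) ≤ α := max_le (by linarith) (by linarith)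
  refine notMem_susceptibleGains (m := 1) (ρ := max 0 (1 - α)) (r := 2) hreg hρ ?_
    (fun β hβ S a _ h0 h1 _ => exp_le_upRate hG hreg hβ (by linarith) hρ (le_max_right _ _) S h0 h1)
    (fun β hβ S a hS h0 h1 hm => downRate_le_of_card_le_two hG hreg hβ (by linarith) hρ
      (le_max_right _ _) hρα hS.le h0 h1 (by omega))
    (fun β hβ S hS => exp_le_upRate_allY hreg hβ (by omega)) h
  push_cast
  rcases max_cases 0 (1 - α) with ⟨h1, h2⟩ | ⟨h1, h2⟩ <;> rw [h1] <;> linarith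

theorem xDeg_eq_two_of_xCount_add_one (hreg : ∀ v, G.degree v = 2) {a : JointAction V} {i : V}
    (hi : a i = Action.y) (h : xCount a + 1 = Fintype.card V) : xDeg G a i = 2 := by
  rw [← xCount_update_x hi, xCount_eq_card] at h
  rw [← xDeg_update_self a i Action.x, h]
  exact (xDeg_eq_two hreg).mpr fun _ _ => rfl

/-- At worst every step costs `1 - α`, except the last: a lone `y` between two `x` switches freely
even if influenced, hence `m = n - 2`. -/
theorem le_of_mem_susceptibleGains [Nonempty V] (hG : G.Preconnected)
    (hreg : ∀ v, G.degree v = 2) {k : ℕ} (hV : 3 ≤ Fintype.card V) (hk : k < Fintype.card V)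
    {α : ℝ} (h : α ∈ susceptibleGains G k) :
    α ≤ ((Fintype.card V : ℝ) - 1) / Fintype.card V := by
  by_contra! hα
  obtain ⟨m, hm⟩ : ∃ m, Fintype.card V = m + 2 := ⟨Fintype.card V - 2, by omega⟩
  have hρ : 0 ≤ max 0 (1 - α) := le_max_left _ _
  have hα0 : 0 < α := h.1
  refine notMem_susceptibleGains (m := m) (ρ := max 0 (1 - α)) (r := 2) hreg hρ ?_
    (fun β hβ S a _ h0 h1 _ => exp_le_upRate hG hreg hβ hα0 hρ (le_max_right _ _) S h0 h1)
    (fun β hβ S a hS h0 h1 hm => ?_)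
    (fun β hβ S hS => exp_le_upRate_allY hreg hβ (by omega)) h
  · rw [hm] at hα
    push_cast at hα
    have hm0 : (0 : ℝ) ≤ m := Nat.cast_nonneg _
    rw [div_lt_iff₀ (by positivity)] at hα
    have hm1 : 3 ≤ (m : ℝ) + 2 := by exact_mod_cast hm ▸ hV
    rcases max_cases 0 (1 - α) with ⟨h1, h2⟩ | ⟨h1, h2⟩ <;> rw [h1] <;> nlinarith
  · obtain ⟨i, hi⟩ := exists_eq_y h1
    refine downRate_le_of_half_le (le_upRate hreg hβ hi le_rfl ?_)
    rw [advantage, xDeg_eq_two_of_xCount_add_one hreg hi (by omega)]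
    push_cast
    split_ifs <;> linarith

/-- For `α > 1` influence no longer hinders the growth of `x`, so only the first step, of cost at
most 3, remains. -/
theorem le_one_of_mem_susceptibleGains [Nonempty V] (hG : G.Preconnected)
    (hreg : ∀ v, G.degree v = 2) {k : ℕ} {α : ℝ} (h : α ∈ susceptibleGains G k) : α ≤ 1 := by
  by_contra! hα
  exact notMem_susceptibleGains (m := 0) (ρ := 0) (r := 3) hreg le_rfl (by norm_num; linarith)
    (fun β _ S a _ h0 _ hm => by omega)
    (fun β hβ S a hS h0 h1 _ => downRate_le_of_half_le
      (exp_le_upRate hG hreg hβ (by linarith) le_rfl (by linarith) S h0 h1))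
    (fun β hβ S hS => exp_three_le_upRate_allY hreg hβ S) h

end Upper

/-! ### Lower bounds: containing policies and a Lyapunov function. -/

section Lower

variable {V : Type*} [Fintype V] [DecidableEq V] {G : SimpleGraph V} [DecidableRel G.Adj]

theorem sum_choiceProb_mul_of_eq_x {α β : ℝ} {S : Finset V} {a : JointAction V} {i : V}
    (hi : a i = Action.x) (f : JointAction V → ℝ) :
    ∑ b, choiceProb G α β S a i b * (f (Function.update a i b) - f a) =
      choiceProb G α β S a i Action.y * (f (Function.update a i Action.y) - f a) := by
  have : Function.update a i Action.x = a := by rw [← hi, Function.update_eq_self]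
  simp [sum_action, this]

theorem sum_choiceProb_mul_of_eq_y {α β : ℝ} {S : Finset V} {a : JointAction V} {i : V}
    (hi : a i = Action.y) (f : JointAction V → ℝ) :
    ∑ b, choiceProb G α β S a i b * (f (Function.update a i b) - f a) =
      choiceProb G α β S a i Action.x * (f (Function.update a i Action.x) - f a) := by
  have : Function.update a i Action.y = a := by rw [← hi, Function.update_eq_self]
  simp [sum_action, this]

/-- A switch of probability at least `c` that lowers `f` by `D` makes up for the other agents if
these raise `f` by at most `B` each. -/
theorem drift_le_of_exists {k : ℕ} {α β : ℝ} {S : MobilePolicy V k} {f : JointAction V → ℝ}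
    {a : JointAction V} {B c D : ℝ} (hB : 0 ≤ B) (hD : 0 ≤ D) {i₀ : V} (hi₀ : a i₀ = Action.x)
    (hc : c ≤ choiceProb G α β (S a).1 a i₀ Action.y)
    (hf : f (Function.update a i₀ Action.y) ≤ f a - D)
    (hx : ∀ i, a i = Action.x → choiceProb G α β (S a).1 a i Action.y *
      (f (Function.update a i Action.y) - f a) ≤ B)
    (hy : ∀ i, a i = Action.y → choiceProb G α β (S a).1 a i Action.x *
      (f (Function.update a i Action.x) - f a) ≤ B) :
    drift G α β S f a ≤ Fintype.card V * B - c * D := by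
  rw [drift, ← add_sum_erase _ _ (mem_univ i₀), sum_choiceProb_mul_of_eq_x hi₀]
  have h1 : choiceProb G α β (S a).1 a i₀ Action.y *
      (f (Function.update a i₀ Action.y) - f a) ≤ -(c * D) := by
    have := choiceProb_nonneg G α β (S a).1 a i₀ Action.y
    nlinarith
  have h2 : ∑ i ∈ univ.erase i₀, ∑ b, choiceProb G α β (S a).1 a i b *
      (f (Function.update a i b) - f a) ≤ Fintype.card V * B := by
    refine (sum_le_card_nsmul _ _ B fun i _ => ?_).trans ?_
    · cases hi : a i
      · rw [sum_choiceProb_mul_of_eq_x hi]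
        exact hx i hi
      · rw [sum_choiceProb_mul_of_eq_y hi]
        exact hy i hi
    · rw [nsmul_eq_mul]
      exact mul_le_mul_of_nonneg_right (by exact_mod_cast card_le_univ _) hB
  linarith

/-- A Lyapunov function that vanishes at `allY V`, is a power of `κ` if the agents playing `x`
form an arc of at most `m` agents, and is close to `1` otherwise. -/
noncomputable def lyapunov (G : SimpleGraph V) [DecidableRel G.Adj] (m : ℕ) (κ l : ℝ)
    (a : JointAction V) : ℝ :=
  if xCount a = 0 then 0
  else if cut G a ≤ 2 ∧ xCount a ≤ m then κ ^ (m + 1 - xCount a) else 1 - l ^ xCount a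

theorem lyapunov_le {m : ℕ} {κ l : ℝ} (hκ0 : 0 ≤ κ) (hκ : κ ≤ 1 / 4) (hl0 : 0 ≤ l)
    (hl : l ≤ 1 / 8) (a : JointAction V) : lyapunov G m κ l a ≤ 1 - l ^ xCount a := by
  unfold lyapunov
  split_ifs with h0 h1
  · simp [h0]
  · have e1 : κ ^ (m + 1 - xCount a) ≤ κ := pow_le_of_le_one hκ0 (by linarith) (by omega)
    have e2 : l ^ xCount a ≤ l := pow_le_of_le_one hl0 (by linarith) h0
    linarith
  · exact le_rfl

theorem lyapunov_le_one {m : ℕ} {κ l : ℝ} (hκ0 : 0 ≤ κ) (hκ : κ ≤ 1 / 4) (hl0 : 0 ≤ l)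
    (hl : l ≤ 1 / 8) (a : JointAction V) : lyapunov G m κ l a ≤ 1 := by
  have := lyapunov_le (G := G) (m := m) hκ0 hκ hl0 hl a
  have := pow_nonneg hl0 (xCount a)
  linarith

theorem lyapunov_nonneg {m : ℕ} {κ l : ℝ} (hκ0 : 0 ≤ κ) (hl0 : 0 ≤ l) (hl : l ≤ 1 / 8)
    (a : JointAction V) : 0 ≤ lyapunov G m κ l a := by
  unfold lyapunov
  split_ifs with h0 h1
  · exact le_rfl
  · positivity
  · exact sub_nonneg.mpr (pow_le_one₀ hl0 (by linarith))

theorem lyapunov_le_pow {m : ℕ} {κ l : ℝ} (hκ0 : 0 ≤ κ) (hl0 : 0 ≤ l) {a : JointAction V}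
    (hcut : cut G a ≤ 2) (ha : xCount a ≤ m + 1) :
    lyapunov G m κ l a ≤ κ ^ (m + 1 - xCount a) := by
  unfold lyapunov
  split_ifs with h0 h1
  · positivity
  · exact le_rfl
  · rw [show m + 1 - xCount a = 0 by omega, pow_zero]
    have := pow_nonneg hl0 (xCount a)
    linarith

/-- A policy for which every mixed joint action has an agent that switches to `y` without
resistance, and that opposes the growth of arcs of at most `m` agents playing `x`. -/
structure IsContaining (G : SimpleGraph V) [DecidableRel G.Adj] {k : ℕ} (m : ℕ)
    (S : MobilePolicy V k) : Prop where
  exists_x : ∀ a, 0 < xCount a → xCount a < Fintype.card V →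
    ∃ i, a i = Action.x ∧ (xDeg G a i = 0 ∨ xDeg G a i = 1 ∧ i ∈ (S a).1)
  mem : ∀ a, cut G a ≤ 2 → 0 < xCount a → xCount a ≤ m →
    ∀ i, a i = Action.y → 0 < xDeg G a i → i ∈ (S a).1

/-- The advantage of `y` is at least 2 for an isolated agent and equals `1 - α > 0` for an
influenced agent with one `x` neighbour. -/
theorem IsContaining.half_le {k m : ℕ} {S : MobilePolicy V k} (hS : IsContaining G m S)
    (hreg : ∀ v, G.degree v = 2) {α β : ℝ} (hβ : 0 < β) (hα : α < 1) {a : JointAction V}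
    (h0 : 0 < xCount a) (h1 : xCount a < Fintype.card V) :
    ∃ i, a i = Action.x ∧ xDeg G a i ≤ 1 ∧ 1 / 2 ≤ choiceProb G α β (S a).1 a i Action.y := by
  obtain ⟨i, hi, h⟩ := hS.exists_x a h0 h1
  refine ⟨i, hi, by omega, ?_⟩
  have := le_choiceProb_y hreg (α := α) (S := (S a).1) (a := a) (i := i) hβ le_rfl ?_
  · simpa using this
  · rw [advantage]
    rcases h with h | ⟨h, hmem⟩
    · rw [h]
      split_ifs <;> norm_num
    · rw [h, if_pos hmem]
      push_cast
      linarith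

/-- The drift in a joint action that is not an arc of at most `m` agents playing `x`. -/
theorem IsContaining.drift_le_of_not {k m : ℕ} {S : MobilePolicy V k} (hS : IsContaining G m S)
    (hreg : ∀ v, G.degree v = 2) {α β : ℝ} (hβ : 0 < β) (hα : α < 1) {κ : ℝ} (hκ0 : 0 ≤ κ)
    (hκ : κ ≤ 1 / 4) {l : ℝ} (hl0 : 0 ≤ l) (hl : l ≤ 1 / 8) (hl' : Fintype.card V * l ≤ 1 / 8)
    {a : JointAction V} (h0 : 0 < xCount a) (h1 : xCount a < Fintype.card V)
    (hbad : ¬ (cut G a ≤ 2 ∧ xCount a ≤ m)) :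
    drift G α β S (lyapunov G m κ l) a ≤ -(l ^ Fintype.card V / 4) := by
  obtain ⟨i₀, hi₀, -, hc⟩ := hS.half_le hreg (α := α) hβ hα h0 h1
  have hw : lyapunov G m κ l a = 1 - l ^ xCount a := by
    rw [lyapunov, if_neg h0.ne', if_neg hbad]
  have hb : ∀ (i : V) (b : Action), choiceProb G α β (S a).1 a i b *
      (lyapunov G m κ l (Function.update a i b) - lyapunov G m κ l a) ≤ l ^ xCount a :=
    fun i b => by
      have e1 := lyapunov_le_one (G := G) (m := m) hκ0 hκ hl0 hl (Function.update a i b)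
      have e2 := choiceProb_nonneg G α β (S a).1 a i b
      have e3 := choiceProb_le_one G α β (S a).1 a i b
      have e4 := pow_nonneg hl0 (xCount a)
      rw [hw]
      nlinarith
  obtain ⟨c, hcc⟩ : ∃ c, xCount a = c + 1 := ⟨xCount a - 1, by omega⟩
  have hcu : xCount (Function.update a i₀ Action.y) = c := by
    have := xCount_update_y hi₀
    omega
  have hlc : 0 ≤ l ^ c := pow_nonneg hl0 c
  -- Since the function never exceeds 1, no switch raises it by more than `l ^ (c + 1)`, while the
  -- switch of `i₀` lowers it by almost `l ^ c`.
  have := drift_le_of_exists (S := S) (pow_nonneg hl0 (xCount a))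
    (D := l ^ c - l ^ (c + 1)) (by rw [pow_succ]; nlinarith) hi₀ hc
    (by
      have := lyapunov_le (G := G) (m := m) hκ0 hκ hl0 hl (Function.update a i₀ Action.y)
      rw [hcu] at this
      rw [hw, hcc]
      linarith) (fun i _ => hb i _) (fun i _ => hb i _)
  have hle : l ^ Fintype.card V ≤ l ^ c := pow_le_pow_of_le_one hl0 (by linarith) (by omega)
  rw [hcc, pow_succ] at this
  nlinarith [mul_le_mul_of_nonneg_left hl hlc, mul_le_mul_of_nonneg_left hl' hlc]

/-- The drift in `allX V`. -/
theorem drift_lyapunov_allX_le [Nonempty V] (hreg : ∀ v, G.degree v = 2) {k m : ℕ} (hk : 1 ≤ k)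
    (hm : m < Fintype.card V) (S : MobilePolicy V k) {α β : ℝ} (hβ : 0 < β) (hα0 : 0 < α) {κ : ℝ}
    (hκ0 : 0 ≤ κ) (hκ : κ ≤ 1 / 4) {l : ℝ} (hl0 : 0 ≤ l) (hl : l ≤ 1 / 8) :
    drift G α β S (lyapunov G m κ l) (allX V) ≤
      -(l ^ Fintype.card V / 4 * Real.exp (-(β * (1 + 2 * α)))) := by
  have hX : xCount (allX V) = Fintype.card V := xCount_eq_card.mpr rfl
  have hcard : 0 < Fintype.card V := Fintype.card_pos
  obtain ⟨c, hc⟩ : ∃ c, Fintype.card V = c + 1 := ⟨Fintype.card V - 1, by omega⟩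
  have hw : lyapunov G m κ l (allX V) = 1 - l ^ (c + 1) := by
    rw [lyapunov, if_neg (by omega), if_neg (by omega), hX, hc]
  have hlc : 0 ≤ l ^ c := pow_nonneg hl0 c
  have hle : l ^ (c + 1) ≤ l ^ c / 8 := by rw [pow_succ]; nlinarith
  have hflip : ∀ i, lyapunov G m κ l (Function.update (allX V) i Action.y) ≤
      lyapunov G m κ l (allX V) - (l ^ c - l ^ (c + 1)) := fun i => by
    have h1 := lyapunov_le (G := G) (m := m) hκ0 hκ hl0 hl (Function.update (allX V) i Action.y)
    have h2 := xCount_update_y (a := allX V) (i := i) rfl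
    rw [show xCount (Function.update (allX V) i Action.y) = c by omega] at h1
    rw [hw]
    linarith
  obtain ⟨i₀, hi₀⟩ : (S (allX V)).1.Nonempty := card_pos.mp (by rw [(S (allX V)).2]; omega)
  have hd : xDeg G (allX V) i₀ = 2 := (xDeg_eq_two hreg).mpr fun _ _ => rfl
  have hp := le_choiceProb_y hreg (S := (S (allX V)).1) (a := allX V) (i := i₀) (α := α) hβ
    (c := 1 + 2 * α) (by linarith) (by
      rw [advantage, hd, if_pos hi₀]
      push_cast
      linarith)
  -- Every switch away from `allX` lowers the function, so there is nothing to compensate.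
  have := drift_le_of_exists (S := S) (B := 0) le_rfl (D := l ^ c - l ^ (c + 1)) (by linarith)
    rfl hp (hflip i₀)
    (fun i _ => mul_nonpos_of_nonneg_of_nonpos (choiceProb_nonneg ..)
      (by linarith [hflip i])) (fun i hi => by simp [allX] at hi)
  rw [hc]
  have he := Real.exp_pos (-(β * (1 + 2 * α)))
  nlinarith

/-- The drift in an arc of at most `m` agents playing `x`. -/
theorem IsContaining.drift_le_of_arc (hG : G.Preconnected) {k m : ℕ} {S : MobilePolicy V k}
    (hS : IsContaining G m S) (hreg : ∀ v, G.degree v = 2) (hm : m + 2 ≤ Fintype.card V)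
    {α β : ℝ} (hβ : 0 < β) (hα0 : 0 < α) (hα : α < 1) (hmα : (m + 1) * (1 - α) ≤ 1) {κ : ℝ}
    (hκe : κ = 8 * Fintype.card V * Real.exp (-(β * (1 - α)))) (hκ : κ ≤ 1 / 4) {l : ℝ}
    (hl0 : 0 ≤ l) (hl : l ≤ 1 / 8) {a : JointAction V} (h0 : 0 < xCount a) (h1 : xCount a ≤ m)
    (hcut : cut G a ≤ 2) :
    drift G α β S (lyapunov G m κ l) a ≤ -(κ ^ m / 4) := by
  obtain ⟨i₀, hi₀, hd₀, hc⟩ := hS.half_le hreg (α := α) hβ hα h0 (by omega)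
  set ε := Real.exp (-(β * (1 - α))) with hε
  have hN : (1 : ℝ) ≤ Fintype.card V := by exact_mod_cast (by omega : 1 ≤ Fintype.card V)
  have hε0 : 0 < ε := Real.exp_pos _
  have hε1 : ε ≤ 1 := Real.exp_le_one_iff.mpr (by nlinarith)
  have hεκ : ε ≤ κ := by rw [hκe]; nlinarith
  have hκ0 : 0 ≤ κ := hε0.le.trans hεκ
  obtain ⟨d, hd⟩ : ∃ d, m = xCount a + d := ⟨m - xCount a, by omega⟩
  have hw : lyapunov G m κ l a = κ ^ (d + 1) := by
    rw [lyapunov, if_neg h0.ne', if_pos ⟨hcut, h1⟩, show m + 1 - xCount a = d + 1 by omega]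
  have hx : ∀ i, a i = Action.x → xDeg G a i ≤ 1 →
      lyapunov G m κ l (Function.update a i Action.y) ≤ κ ^ (d + 2) := fun i hi hdi => by
    have e1 := cut_update_y hreg hi
    have e2 := xCount_update_y hi
    refine (lyapunov_le_pow hκ0 hl0 (by omega) (by omega)).trans_eq ?_
    congr 1
    omega
  have hpow : κ ^ (d + 2) ≤ κ ^ (d + 1) := pow_le_pow_of_le_one hκ0 (by linarith) (by omega)
  have hB0 : 0 ≤ ε * κ ^ d := by positivity
  have hone : ∀ (i : V) (b : Action), choiceProb G α β (S a).1 a i b ≤ ε ^ (m + 1) →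
      choiceProb G α β (S a).1 a i b *
        (lyapunov G m κ l (Function.update a i b) - lyapunov G m κ l a) ≤ ε * κ ^ d :=
    fun i b hib => by
      have e1 := lyapunov_le_one (G := G) (m := m) hκ0 hκ hl0 hl (Function.update a i b)
      have e2 := choiceProb_nonneg G α β (S a).1 a i b
      have e3 := lyapunov_nonneg (G := G) (m := m) hκ0 hl0 hl a
      have e4 : ε ^ (m + 1) ≤ ε * κ ^ d := by
        calc ε ^ (m + 1) ≤ ε ^ (d + 1) := pow_le_pow_of_le_one hε0.le hε1 (by omega)
          _ = ε * ε ^ d := by rw [pow_succ, mul_comm]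
          _ ≤ ε * κ ^ d := by gcongr
      nlinarith
  -- Here `hmα` enters: a switch that breaks the arc may raise the function almost to 1, but it
  -- costs at least 1, which is as much as `m + 1` growth steps of cost `1 - α`.
  have hεm : Real.exp (-(β * 1)) ≤ ε ^ (m + 1) := by
    rw [hε, ← Real.exp_nat_mul]
    refine Real.exp_le_exp.mpr ?_
    push_cast
    nlinarith
  have hexp : ∀ t : ℝ, 1 ≤ t → Real.exp (-(β * t)) ≤ ε ^ (m + 1) := fun t ht =>
    (Real.exp_le_exp.mpr (by nlinarith)).trans hεm
  have := drift_le_of_exists (S := S) (f := lyapunov G m κ l) hB0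
    (D := κ ^ (d + 1) - κ ^ (d + 2)) (by linarith) hi₀ hc
    (by rw [hw]; linarith [hx i₀ hi₀ hd₀])
    (fun i hi => by
      by_cases hdi : xDeg G a i ≤ 1
      · refine (mul_nonpos_of_nonneg_of_nonpos (choiceProb_nonneg ..) ?_).trans hB0
        rw [hw]
        linarith [hx i hi hdi]
      · have hdi2 : xDeg G a i = 2 := le_antisymm (xDeg_le hreg a i) (by omega)
        refine hone i _ ((choiceProb_y_le hreg hβ (c := 1 + 2 * α) ?_).trans
          (hexp _ (by linarith)))
        rw [advantage, hdi2]
        push_cast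
        split_ifs <;> linarith)
    (fun i hi => by
      have h2 := xDeg_le hreg a i
      by_cases hdi : xDeg G a i = 0
      · refine hone i _ ((choiceProb_x_le hreg hβ (c := 2) ?_).trans (hexp _ (by norm_num)))
        rw [advantage, hdi]
        split_ifs <;> norm_num
      · have hdi1 : xDeg G a i = 1 := by
          by_contra hne
          have := xCount_add_one_of_xDeg_eq_two hG hreg hcut hi (by omega)
          omega
        have hp : choiceProb G α β (S a).1 a i Action.x ≤ ε := by
          refine choiceProb_x_le hreg hβ ?_
          rw [advantage, hdi1, if_pos (hS.mem a hcut h0 h1 i hi (by omega))]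
          push_cast
          linarith
        have e1 := cut_update_x hreg hi
        have e2 := xCount_update_x hi
        have e3 := lyapunov_le_pow (G := G) (m := m) (a := Function.update a i Action.x) hκ0 hl0
          (by omega) (by omega)
        rw [show m + 1 - xCount (Function.update a i Action.x) = d by omega] at e3
        have e4 := lyapunov_nonneg (G := G) (m := m) hκ0 hl0 hl a
        have e5 := choiceProb_nonneg G α β (S a).1 a i Action.x
        have e6 := pow_nonneg hκ0 d
        calc _ ≤ choiceProb G α β (S a).1 a i Action.x * κ ^ d :=
              mul_le_mul_of_nonneg_left (by linarith) e5
          _ ≤ _ := mul_le_mul_of_nonneg_right hp e6)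
  -- The factor `8N` in `κ` makes the total upward contribution a fraction of the downward one.
  have e1 : Fintype.card V * (ε * κ ^ d) = κ ^ (d + 1) / 8 := by
    rw [pow_succ]
    nth_rw 3 [hκe]
    ring
  have e2 : κ ^ (d + 2) ≤ κ ^ (d + 1) / 4 := by
    rw [pow_succ]
    have := pow_nonneg hκ0 (d + 1)
    nlinarith
  have e3 : κ ^ m ≤ κ ^ (d + 1) := pow_le_pow_of_le_one hκ0 (by linarith) (by omega)
  linarith

/-- The drift in `allY V`. -/
theorem drift_lyapunov_allY_le (hreg : ∀ v, G.degree v = 2) {k m : ℕ} {S : MobilePolicy V k}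
    {α β r : ℝ} (hβ : 0 < β) (hr : ∀ i, r ≤ 2 + if i ∈ (S (allY V)).1 then 1 else 0) {κ : ℝ}
    (hκ0 : 0 ≤ κ) {l : ℝ} (hl0 : 0 ≤ l) :
    drift G α β S (lyapunov G m κ l) (allY V) ≤
      Fintype.card V * (Real.exp (-(β * r)) * κ ^ m) := by
  have hY : xCount (allY V) = 0 := xCount_eq_zero.mpr rfl
  have hd : ∀ i, xDeg G (allY V) i = 0 := fun i => by simp [xDeg, allY]
  refine (sum_le_card_nsmul _ _ (Real.exp (-(β * r)) * κ ^ m) fun i _ => ?_).trans_eq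
    (by rw [nsmul_eq_mul, card_univ])
  rw [sum_choiceProb_mul_of_eq_y rfl]
  have hcut : cut G (allY V) = 0 := by simp [cut, hd]
  have e1 := cut_update_x hreg (a := allY V) (i := i) rfl
  have e2 := xCount_update_x (a := allY V) (i := i) rfl
  have e3 := lyapunov_le_pow (G := G) (m := m) (a := Function.update (allY V) i Action.x) hκ0 hl0
    (by omega) (by omega)
  rw [e2, hY, Nat.zero_add, Nat.add_sub_cancel] at e3
  have e4 : lyapunov G m κ l (allY V) = 0 := by rw [lyapunov, if_pos hY]
  have e5 : choiceProb G α β (S (allY V)).1 (allY V) i Action.x ≤ Real.exp (-(β * r)) := by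
    refine choiceProb_x_le hreg hβ ?_
    rw [advantage, hd]
    have := hr i
    push_cast
    linarith
  rw [e4, sub_zero]
  calc _ ≤ choiceProb G α β (S (allY V)).1 (allY V) i Action.x * κ ^ m :=
        mul_le_mul_of_nonneg_left e3 (choiceProb_nonneg ..)
    _ ≤ _ := mul_le_mul_of_nonneg_right e5 (pow_nonneg hκ0 m)

/-- Against a containing policy, the stationary mass outside `allY V` is exponentially small. -/
theorem IsContaining.one_sub_le [Nonempty V] (hG : G.Preconnected) {k m : ℕ} (hk : 1 ≤ k)
    {S : MobilePolicy V k} (hS : IsContaining G m S) (hreg : ∀ v, G.degree v = 2)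
    (hm : m + 2 ≤ Fintype.card V) {α β r : ℝ} (hβ : 0 < β) (hα0 : 0 < α) (hα : α < 1)
    (hmα : (m + 1) * (1 - α) ≤ 1) (hr : ∀ i, r ≤ 2 + if i ∈ (S (allY V)).1 then 1 else 0)
    (hκ : 8 * Fintype.card V * Real.exp (-(β * (1 - α))) ≤ 1 / 4) {p : JointAction V → ℝ}
    (h : IsStationaryDistribution (transitionMatrix G α β S) p) :
    1 - p (allY V) ≤ 4 * Fintype.card V * (8 * Fintype.card V) ^ (m + Fintype.card V) *
      Real.exp (-(β * (r + m * (1 - α) - (1 + 2 * α)))) := by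
  set N := Fintype.card V with hN
  have hN2 : (2 : ℝ) ≤ N := by exact_mod_cast (by omega : 2 ≤ N)
  set l : ℝ := 1 / (8 * N) with hl
  have hl0 : 0 < l := by positivity
  have hl8 : l ≤ 1 / 8 := one_div_le_one_div_of_le (by norm_num) (by linarith)
  have hNl : N * l ≤ 1 / 8 := by rw [hl]; field_simp; norm_num
  set ε := Real.exp (-(β * (1 - α))) with hε
  set κ := 8 * N * ε with hκe
  have hε0 : 0 < ε := Real.exp_pos _
  have hκ0 : 0 ≤ κ := by positivity
  set q := Real.exp (-(β * (1 + 2 * α))) with hq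
  have hq0 : 0 < q := Real.exp_pos _
  have hq1 : q ≤ 1 := Real.exp_le_one_iff.mpr (by nlinarith)
  have hlN0 : 0 < l ^ N := by positivity
  have hlN1 : l ^ N ≤ 1 := pow_le_one₀ hl0.le (by linarith)
  have hqκ : q ≤ κ ^ m := by
    calc q ≤ ε ^ m := by
          rw [hε, ← Real.exp_nat_mul]
          refine Real.exp_le_exp.mpr ?_
          nlinarith
      _ ≤ κ ^ m := pow_le_pow_left₀ hε0.le (by rw [hκe]; nlinarith) m
  -- The bottleneck is `allX`, whose drift is of order `q`; `hqκ` and `hq1` show that the drift at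
  -- arcs and at other mixed states is at least as negative.
  have key := h.one_sub_le G (lyapunov G m κ l) (allY V)
    (ζ := N * (Real.exp (-(β * r)) * κ ^ m)) (η := l ^ N / 4 * q) (by positivity) (by positivity)
    (drift_lyapunov_allY_le hreg hβ hr hκ0 hl0.le) (fun a ha => by
      have h0 : 0 < xCount a := Nat.pos_of_ne_zero fun h0 => ha (xCount_eq_zero.mp h0)
      rcases (xCount_le a).eq_or_lt with hX | hlt
      · rw [xCount_eq_card.mp hX]
        exact drift_lyapunov_allX_le hreg hk (by omega) S hβ hα0 hκ0 hκ hl0.le hl8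
      by_cases hgood : cut G a ≤ 2 ∧ xCount a ≤ m
      · refine (hS.drift_le_of_arc hG hreg hm hβ hα0 hα hmα hκe hκ hl0.le hl8 h0 hgood.2
          hgood.1).trans ?_
        nlinarith
      · refine (hS.drift_le_of_not hreg hβ hα hκ0 hκ hl0.le hl8 hNl h0 hlt hgood).trans ?_
        nlinarith)
  refine key.trans_eq ?_
  have e1 : Real.exp (-(β * (r + m * (1 - α) - (1 + 2 * α)))) =
      Real.exp (-(β * r)) * ε ^ m / q := by
    rw [hε, hq, ← Real.exp_nat_mul, ← Real.exp_add, ← Real.exp_sub]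
    congr 1
    ring
  rw [e1, hκe, mul_pow, hl, one_div, inv_pow, pow_add]
  field_simp

theorem IsContaining.stochasticallyStable_eq [Nonempty V] (hG : G.Preconnected) {k m : ℕ}
    (hk : 1 ≤ k) {S : MobilePolicy V k} (hS : IsContaining G m S) (hreg : ∀ v, G.degree v = 2)
    (hm : m + 2 ≤ Fintype.card V) {α r : ℝ} (hα0 : 0 < α) (hα : α < 1)
    (hmα : (m + 1) * (1 - α) ≤ 1) (hr : ∀ i, r ≤ 2 + if i ∈ (S (allY V)).1 then 1 else 0)
    (hrα : 1 + 2 * α < r + m * (1 - α)) : stochasticallyStable G α S = {allY V} := by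
  have hexp : ∀ c : ℝ, 0 < c → ∀ C : ℝ,
      Filter.Tendsto (fun β : ℝ => C * Real.exp (-(β * c))) Filter.atTop (nhds 0) := by
    intro c hc C
    rw [← mul_zero C]
    refine Filter.Tendsto.const_mul _ (Real.tendsto_exp_neg_atTop_nhds_zero.comp ?_)
    exact Filter.tendsto_id.atTop_mul_const hc
  have hY : ∀ p : ℝ → JointAction V → ℝ,
      (∀ β, 0 < β → IsStationaryDistribution (transitionMatrix G α β S) (p β)) →
      Filter.Tendsto (fun β => 1 - p β (allY V)) Filter.atTop (nhds 0) := by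
    intro p hp
    refine tendsto_of_tendsto_of_tendsto_of_le_of_le' tendsto_const_nhds
      (hexp (r + m * (1 - α) - (1 + 2 * α)) (by linarith)
        (4 * Fintype.card V * (8 * Fintype.card V) ^ (m + Fintype.card V))) ?_ ?_
    · filter_upwards [Filter.eventually_gt_atTop (0 : ℝ)] with β hβ
      rw [sub_nonneg, ← (hp β hβ).1.2]
      exact single_le_sum (fun a _ => (hp β hβ).1.1 a) (mem_univ _)
    · filter_upwards [Filter.eventually_gt_atTop (0 : ℝ),
        (hexp (1 - α) (by linarith) (8 * Fintype.card V)).eventually_le_const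
          (show (0 : ℝ) < 1 / 4 by norm_num)] with β hβ hκ
      exact hS.one_sub_le hG hk hreg hm hβ hα0 hα hmα hr hκ (hp β hβ)
  have hne : ∀ p : ℝ → JointAction V → ℝ,
      (∀ β, 0 < β → IsStationaryDistribution (transitionMatrix G α β S) (p β)) →
      ∀ a, a ≠ allY V → Filter.Tendsto (fun β => p β a) Filter.atTop (nhds 0) := by
    intro p hp a ha
    refine tendsto_of_tendsto_of_tendsto_of_le_of_le' tendsto_const_nhds (hY p hp) ?_ ?_
    · filter_upwards [Filter.eventually_gt_atTop (0 : ℝ)] with β hβ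
      exact (hp β hβ).1.1 a
    · filter_upwards [Filter.eventually_gt_atTop (0 : ℝ)] with β hβ
      have h1 : p β a + p β (allY V) ≤ 1 := by
        rw [← (hp β hβ).1.2, ← sum_pair ha]
        exact sum_le_sum_of_subset_of_nonneg (subset_univ _) fun b _ _ => (hp β hβ).1.1 b
      linarith
  ext a
  simp only [stochasticallyStable, Set.mem_ofPred_eq, Set.mem_singleton_iff]
  constructor
  · rintro ⟨μ, ⟨p, hp, hlim⟩, hμ⟩
    by_contra ha
    rw [tendsto_nhds_unique (hlim a) (hne p hp a ha)] at hμ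
    exact hμ.false
  · rintro rfl
    have : Nonempty (JointAction V) := ⟨allY V⟩
    choose p hp using fun β : ℝ => exists_isStationaryDistribution (transitionMatrix G α β S)
      (transitionMatrix_nonneg G α β S) (sum_transitionMatrix G α β S)
    refine ⟨fun a => if a = allY V then 1 else 0, ⟨p, fun β _ => hp β, fun a => ?_⟩, by simp⟩
    by_cases ha : a = allY V
    · subst ha
      simpa using (hY p fun β _ => hp β).const_sub 1
    · simp only [if_neg ha]
      exact hne p (fun β _ => hp β) a ha

theorem one_lt_xCount {a : JointAction V} {i : V} (hi : a i = Action.x) (hd : 0 < xDeg G a i) :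
    1 < xCount a := by
  obtain ⟨j, hij, hj⟩ := xDeg_pos.mp hd
  exact one_lt_card.mpr ⟨i, by simp [hi], j, by simp [hj], hij.ne⟩

/-- At most two agents border an arc, and one influenced end of it makes it shrink; an arc of one
agent needs no such help. This gives the budgets 1, 2 and 3 for `m = 0`, `m = 1` and arbitrary `m`;
spare influence is spent anywhere. -/
theorem exists_isContaining (hG : G.Preconnected) (hreg : ∀ v, G.degree v = 2) {k m : ℕ}
    (hk : k ≤ Fintype.card V) (hkm : m = 0 ∧ 1 ≤ k ∨ m = 1 ∧ 2 ≤ k ∨ 3 ≤ k) :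
    ∃ S : MobilePolicy V k, IsContaining G m S := by
  classical
  suffices ∀ a : JointAction V, ∃ S : {S : Finset V // S.card = k},
      (0 < xCount a → xCount a < Fintype.card V →
        ∃ i, a i = Action.x ∧ (xDeg G a i = 0 ∨ xDeg G a i = 1 ∧ i ∈ S.1)) ∧
      (cut G a ≤ 2 → 0 < xCount a → xCount a ≤ m →
        ∀ i, a i = Action.y → 0 < xDeg G a i → i ∈ S.1) by
    choose S hS using this
    exact ⟨S, fun a => (hS a).1, fun a => (hS a).2⟩
  intro a
  obtain ⟨B, hBcard, hB⟩ : ∃ B : Finset V, B.card + (if xCount a = 1 then 0 else 1) ≤ k ∧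
      (cut G a ≤ 2 → 0 < xCount a → xCount a ≤ m →
        ∀ i, a i = Action.y → 0 < xDeg G a i → i ∈ B) := by
    by_cases hgood : cut G a ≤ 2 ∧ 0 < xCount a ∧ xCount a ≤ m
    · refine ⟨univ.filter fun i => a i = Action.y ∧ 0 < xDeg G a i, ?_,
        fun _ _ _ i hi hd => by simp [hi, hd]⟩
      have := card_boundary_le (G := G) a
      split_ifs <;> omega
    · refine ⟨∅, ?_, fun h1 h2 h3 => absurd ⟨h1, h2, h3⟩ hgood⟩
      rw [card_empty]
      split_ifs <;> omega
  obtain ⟨A, hAcard, hA⟩ : ∃ A : Finset V, A.card ≤ (if xCount a = 1 then 0 else 1) ∧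
      (0 < xCount a → xCount a < Fintype.card V →
        ∃ i, a i = Action.x ∧ (xDeg G a i = 0 ∨ xDeg G a i = 1 ∧ i ∈ A)) := by
    by_cases hmix : 0 < xCount a ∧ xCount a < Fintype.card V
    · obtain ⟨i, hi, hd⟩ := exists_x_xDeg_lt hG hreg hmix.1 hmix.2
      rcases Nat.eq_zero_or_pos (xDeg G a i) with h0 | h0
      · exact ⟨∅, by simp, fun _ _ => ⟨i, hi, Or.inl h0⟩⟩
      · refine ⟨{i}, ?_, fun _ _ => ⟨i, hi, Or.inr ⟨by omega, mem_singleton_self i⟩⟩⟩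
        have := one_lt_xCount hi h0
        rw [card_singleton, if_neg (by omega)]
    · exact ⟨∅, by simp, fun h1 h2 => absurd ⟨h1, h2⟩ hmix⟩
  obtain ⟨S, hsub, -, hS⟩ := exists_subsuperset_card_eq (subset_univ (B ∪ A)) (n := k)
    ((card_union_le B A).trans (by omega)) (by rwa [card_univ])
  refine ⟨⟨S, hS⟩, fun h0 h1 => ?_, fun h1 h2 h3 i hi hd =>
    hsub (mem_union_left _ (hB h1 h2 h3 i hi hd))⟩
  obtain ⟨i, hi, h⟩ := hA h0 h1
  exact ⟨i, hi, h.imp_right fun h => ⟨h.1, hsub (mem_union_right _ h.2)⟩⟩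

/-- The lower end of the window says `(m + 1)(1 - α) ≤ 1`, the upper end `1 + 2α < 2 + m(1 - α)`. -/
theorem mem_susceptibleGains [Nonempty V] (hG : G.Preconnected) (hreg : ∀ v, G.degree v = 2)
    {k m : ℕ} (hk : k ≤ Fintype.card V) (hkm : m = 0 ∧ 1 ≤ k ∨ m = 1 ∧ 2 ≤ k ∨ 3 ≤ k)
    (hm : m + 2 ≤ Fintype.card V) {α : ℝ} (hα0 : 0 < α) (hmα : (m : ℝ) / (m + 1) ≤ α)
    (hα : α < (m + 1 : ℝ) / (m + 2)) : α ∈ susceptibleGains G k := by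
  obtain ⟨S, hS⟩ := exists_isContaining hG hreg hk hkm
  have hm0 : (0 : ℝ) ≤ m := Nat.cast_nonneg _
  rw [lt_div_iff₀ (by positivity)] at hα
  rw [div_le_iff₀ (by positivity)] at hmα
  refine ⟨hα0, S, hS.stochasticallyStable_eq hG (by omega) hreg hm hα0 (by nlinarith)
    (by nlinarith) (r := 2) (fun i => ?_) (by nlinarith)⟩
  split_ifs <;> norm_num

/-- Everybody is influenced at `allY`, so the first step costs 3, and `3 > 1 + 2α` without any
control of arcs (`m = 0`). -/
theorem mem_susceptibleGains_card [Nonempty V] (hG : G.Preconnected)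
    (hreg : ∀ v, G.degree v = 2) (hV : 3 ≤ Fintype.card V) {α : ℝ} (hα0 : 0 < α) (hα : α < 1) :
    α ∈ susceptibleGains G (Fintype.card V) := by
  obtain ⟨S, hS⟩ := exists_isContaining (m := 0) hG hreg le_rfl (by omega)
  refine ⟨hα0, S, hS.stochasticallyStable_eq hG (by omega) hreg (by omega) hα0 hα
    (by norm_num; linarith) (r := 3) (fun i => ?_) (by norm_num; linarith)⟩
  rw [(card_eq_iff_eq_univ _).mp (S (allY V)).2]
  norm_num

end Lower

/-! ### The suprema in the four regimes. -/

section Susceptibility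

theorem isLUB_of_Ioo_subset {s : Set ℝ} {l b : ℝ} (hlb : l < b) (hs : ∀ x ∈ s, x ≤ b)
    (h : ∀ x, l < x → x < b → x ∈ s) : IsLUB s b := by
  refine ⟨hs, fun c hc => ?_⟩
  by_contra! hcb
  obtain ⟨x, hx, hxb⟩ := exists_between (max_lt hlb hcb)
  exact absurd (hc (h x ((le_max_left _ _).trans_lt hx) hxb))
    (not_le.mpr ((le_max_right _ _).trans_lt hx))

variable {V : Type*} [Fintype V] [DecidableEq V] {G : SimpleGraph V} [DecidableRel G.Adj]

theorem isLUB_susceptibleGains_of_le [Nonempty V] (hG : G.Preconnected)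
    (hreg : ∀ v, G.degree v = 2) {k m : ℕ} (hk : k ≤ Fintype.card V)
    (hkm : m = 0 ∧ 1 ≤ k ∨ m = 1 ∧ 2 ≤ k ∨ 3 ≤ k) (hm : m + 2 ≤ Fintype.card V) {t : ℝ}
    (ht : t = (m + 1 : ℝ) / (m + 2)) (hle : ∀ α ∈ susceptibleGains G k, α ≤ t) :
    IsLUB (susceptibleGains G k) t := by
  have hm0 : (0 : ℝ) ≤ m := Nat.cast_nonneg _
  have h0 : (0 : ℝ) ≤ m / (m + 1) := by positivity
  subst ht
  refine isLUB_of_Ioo_subset (l := (m : ℝ) / (m + 1)) ?_ hle fun α hα hα' =>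
    mem_susceptibleGains hG hreg hk hkm hm (h0.trans_lt hα) hα.le hα'
  rw [div_lt_div_iff₀ (by positivity) (by positivity)]
  nlinarith

theorem isLUB_susceptibleGains_one [Nonempty V] (hG : G.Preconnected)
    (hreg : ∀ v, G.degree v = 2) (hV : 3 ≤ Fintype.card V) :
    IsLUB (susceptibleGains G 1) (1 / 2) :=
  isLUB_susceptibleGains_of_le (m := 0) hG hreg (by omega) (by omega) (by omega) (by norm_num)
    fun _ => le_of_mem_susceptibleGains_one hG hreg hV

theorem isLUB_susceptibleGains_two [Nonempty V] (hG : G.Preconnected)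
    (hreg : ∀ v, G.degree v = 2) (hV : 3 ≤ Fintype.card V) :
    IsLUB (susceptibleGains G 2) (2 / 3) :=
  isLUB_susceptibleGains_of_le (m := 1) hG hreg (by omega) (by omega) (by omega) (by norm_num)
    fun _ => le_of_mem_susceptibleGains_two hG hreg hV

theorem isLUB_susceptibleGains [Nonempty V] (hG : G.Preconnected) (hreg : ∀ v, G.degree v = 2)
    {k : ℕ} (hk3 : 3 ≤ k) (hk : k < Fintype.card V) :
    IsLUB (susceptibleGains G k) (((Fintype.card V : ℝ) - 1) / Fintype.card V) := by
  obtain ⟨m, hm⟩ : ∃ m, Fintype.card V = m + 2 := ⟨Fintype.card V - 2, by omega⟩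
  refine isLUB_susceptibleGains_of_le (m := m) hG hreg hk.le (by omega) hm.ge ?_
    fun _ => le_of_mem_susceptibleGains hG hreg (by omega) hk
  rw [hm]
  push_cast
  ring

theorem isLUB_susceptibleGains_card [Nonempty V] (hG : G.Preconnected)
    (hreg : ∀ v, G.degree v = 2) (hV : 3 ≤ Fintype.card V) :
    IsLUB (susceptibleGains G (Fintype.card V)) 1 :=
  isLUB_of_Ioo_subset zero_lt_one (fun _ => le_one_of_mem_susceptibleGains hG hreg)
    fun _ => mem_susceptibleGains_card hG hreg hV

/-- The empty set has no least upper bound in `ℝ`, so non-emptiness comes for free and `sSup` takes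
no default value. -/
theorem _root_.IsLUB.susceptibility_eq {k : ℕ} {t : ℝ} (h : IsLUB (susceptibleGains G k) t) :
    susceptibility G k = t := by
  refine h.csSup_eq (Set.nonempty_iff_ne_empty.mpr fun he => ?_)
  rw [he] at h
  exact absurd (h.2 (show t - 1 ∈ upperBounds ∅ by simp)) (by linarith)

end Susceptibility

end CoordinationGame

theorem theorem5 (n k : ℕ) (hn : 3 ≤ n) (hk : 1 ≤ k) (hkn : k ≤ n) :
    IsLUB (CoordinationGame.susceptibleGains (SimpleGraph.cycleGraph n) k)
        (CoordinationGame.susceptibility (SimpleGraph.cycleGraph n) k) ∧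
      (k = 1 ∨ k = 2 →
        CoordinationGame.susceptibility (SimpleGraph.cycleGraph n) k = (k : ℝ) / ((k : ℝ) + 1)) ∧
      (3 ≤ k → k ≤ n - 1 →
        CoordinationGame.susceptibility (SimpleGraph.cycleGraph n) k = ((n : ℝ) - 1) / (n : ℝ)) ∧
      (k = n → CoordinationGame.susceptibility (SimpleGraph.cycleGraph n) k = 1) := by
  have hG : (SimpleGraph.cycleGraph n).Preconnected := SimpleGraph.cycleGraph_preconnected
  have hreg : ∀ v, (SimpleGraph.cycleGraph n).degree v = 2 := by
    obtain ⟨m, rfl⟩ : ∃ m, n = m + 3 := ⟨n - 3, by omega⟩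
    exact fun v => SimpleGraph.cycleGraph_degree_three_le
  have : Nonempty (Fin n) := ⟨⟨0, by omega⟩⟩
  have hV : 3 ≤ Fintype.card (Fin n) := by rwa [Fintype.card_fin]
  obtain rfl | rfl | h3 : k = 1 ∨ k = 2 ∨ 3 ≤ k := by omega
  · have h := CoordinationGame.isLUB_susceptibleGains_one hG hreg hV
    rw [h.susceptibility_eq]
    exact ⟨h, fun _ => by norm_num, fun _ _ => by omega, fun _ => by omega⟩
  · have h := CoordinationGame.isLUB_susceptibleGains_two hG hreg hV
    rw [h.susceptibility_eq]
    exact ⟨h, fun _ => by norm_num, fun _ _ => by omega, fun _ => by omega⟩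
  obtain hlt | rfl := hkn.lt_or_eq
  · have h := CoordinationGame.isLUB_susceptibleGains hG hreg h3 (by rwa [Fintype.card_fin])
    rw [Fintype.card_fin] at h
    rw [h.susceptibility_eq]
    exact ⟨h, fun _ => by omega, fun _ _ => rfl, fun _ => by omega⟩
  · have h := CoordinationGame.isLUB_susceptibleGains_card hG hreg hV
    rw [Fintype.card_fin] at h
    rw [h.susceptibility_eq]
    exact ⟨h, fun _ => by omega, fun _ _ => by omega, fun _ => rfl⟩
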